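/- Work over $\mathbb{C}$. Let $r\geq 1$ and let $\mathbf{n}=(n_1,\dots,n_r)$, $\mathbf{d}=(d_1,\dots,d_r)$ be $r$-tuples of positive integers with $n_1\leq\dots\leq n_r$. Let $SV^{\mathbf{n}}_{\mathbf{d}}\subset\mathbb{P}^N$, $N=\prod_{i=1}^r\binom{n_i+d_i}{d_i}-1$, be the Segre–Veronese variety, that is, the image of $\mathbb{P}^{n_1}\times\dots\times\mathbb{P}^{n_r}$ under the embedding given by the complete linear system $|\mathcal{O}(d_1,\dots,d_r)|$. For a variety $X\subset\mathbb{P}^N$, a point $x\in X$ and a hyperplane $H\supseteq T_xX$, the contact locus of $X$ with respect to $x$ and $H$ is the closure of the union of the irreducible components containing $x$ of the locus $\{y\in X : T_yX\subseteq H\}$ (which for $X$ smooth and $X\not\subseteq H$ is $\operatorname{Sing}(X\cap H)$). The variety $X$ is $1$-weakly defective if, for a general point $x\in X$ and a general hyperplane $H$ containing $T_xX$, this contact locus has positive dimension. Here "general" means "in a dense Zariski open subset" (so that for $X=\mathbb{P}^N$, where no hyperplane contains $T_xX$, the condition holds vacuously). The dual variety $X^{\vee}\subset(\mathbb{P}^N)^{\vee}$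 is the Zariski closure of the set of hyperplanes tangent to $X$ at some smooth point, and a hypersurface is the zero locus of one nonzero homogeneous polynomial of positive degree. **Theorem.** The Segre–Veronese variety $SV^{\mathbf{n}}_{\mathbf{d}}$ is $1$-weakly defective if and only if $d_r=1$ and $n_r>\sum_{i=1}^{r-1}n_i$. Moreover, the dual variety of $SV^{\mathbf{n}}_{\mathbf{d}}$ is a hypersurface if and only if it is not the case that $d_r=1$ and $n_r>\sum_{i=1}^{r-1}n_i$. -/

import Mathlib

open scoped LinearAlgebra.Projectivization

noncomputable section

namespace SegreVeronese

/-- Complex projective space with homogeneous coordinates indexed by `σ`. -/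
abbrev PSpace (σ : Type) : Type := ℙ ℂ (σ → ℂ)

section Projective

variable {σ : Type}

/-- The zero locus in projective space of a homogeneous polynomial. -/
def hypersurface (F : MvPolynomial σ ℂ) : Set (PSpace σ) :=
  {p | MvPolynomial.eval p.rep F = 0}

/-- The common zero locus of a set of (homogeneous) polynomials. -/
def zeroLocus (S : Set (MvPolynomial σ ℂ)) : Set (PSpace σ) :=
  {p | ∀ F ∈ S, MvPolynomial.eval p.rep F = 0}

/-- Algebraic subsets: common zero loci of sets of homogeneous polynomials. -/
def IsAlgebraic (Z : Set (PSpace σ)) : Prop :=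
  ∃ S : Set (MvPolynomial σ ℂ), (∀ F ∈ S, ∃ k : ℕ, F.IsHomogeneous k) ∧ Z = zeroLocus S

theorem isAlgebraic_empty : IsAlgebraic (∅ : Set (PSpace σ)) := by
  refine ⟨{1}, ?_, ?_⟩
  · rintro F rfl
    exact ⟨0, MvPolynomial.isHomogeneous_one σ ℂ⟩
  · ext p
    simp [zeroLocus]

theorem isAlgebraic_sInter (A : Set (Set (PSpace σ))) (hA : A ⊆ {Z | IsAlgebraic Z}) :
    IsAlgebraic (⋂₀ A) := by
  refine ⟨{F | (∃ k : ℕ, F.IsHomogeneous k) ∧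
    ∃ Z ∈ A, ∀ p ∈ Z, MvPolynomial.eval p.rep F = 0}, fun F hF => hF.1, ?_⟩
  ext p
  constructor
  · rintro hp F ⟨-, Z, hZ, hF⟩
    exact hF p (hp Z hZ)
  · intro hp Z hZ
    obtain ⟨S, hS, rfl⟩ := hA hZ
    intro F hF
    exact hp F ⟨hS F hF, _, hZ, fun q hq => hq F hF⟩

theorem isAlgebraic_union (A : Set (PSpace σ)) (hA : IsAlgebraic A) (B : Set (PSpace σ))
    (hB : IsAlgebraic B) : IsAlgebraic (A ∪ B) := by
  obtain ⟨S, hS, rfl⟩ := hA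
  obtain ⟨T, hT, rfl⟩ := hB
  refine ⟨{F | ∃ G ∈ S, ∃ H ∈ T, F = G * H}, ?_, ?_⟩
  · rintro F ⟨G, hG, H, hH, rfl⟩
    obtain ⟨a, ha⟩ := hS G hG
    obtain ⟨b, hb⟩ := hT H hH
    exact ⟨a + b, ha.mul hb⟩
  · ext p
    constructor
    · rintro (hp | hp) F ⟨G, hG, H, hH, rfl⟩
      · simp [hp G hG]
      · simp [hp H hH]
    · intro hp
      by_contra hcon
      simp only [zeroLocus, Set.mem_union, Set.mem_ofPred_eq, not_or, not_forall] at hcon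
      obtain ⟨⟨G, hG, hG0⟩, ⟨H, hH, hH0⟩⟩ := hcon
      have := hp (G * H) ⟨G, hG, H, hH, rfl⟩
      rw [map_mul, mul_eq_zero] at this
      exact this.elim hG0 hH0

/-- The Zariski topology on projective space. -/
instance zariskiTopology : TopologicalSpace (PSpace σ) :=
  TopologicalSpace.ofClosed {Z | IsAlgebraic Z} isAlgebraic_empty isAlgebraic_sInter
    isAlgebraic_union

/-- `P y` holds for a general point `y` of `Y`: it holds at all points of a dense relatively
Zariski open subset of `Y`. -/
def ForGeneral (Y : Set (PSpace σ)) (P : PSpace σ → Prop) : Prop :=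
  ∃ U : Set (PSpace σ), IsOpen U ∧ Y ⊆ closure (U ∩ Y) ∧ ∀ y ∈ U ∩ Y, P y

/-- `F` is a homogeneous polynomial in the ideal of `X`. -/
def VanishesOn (X : Set (PSpace σ)) (F : MvPolynomial σ ℂ) : Prop :=
  (∃ k : ℕ, F.IsHomogeneous k) ∧ ∀ p ∈ X, MvPolynomial.eval p.rep F = 0

variable [Fintype σ]

/-- The linear subspace of `σ → ℂ` whose projectivization is the embedded projective tangent
space `T_x X`: the common kernel of the differentials at `x` of the homogeneous polynomials
vanishing on `X`. -/
def tangentSpace (X : Set (PSpace σ)) (x : PSpace σ) : Submodule ℂ (σ → ℂ) where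
  carrier := {v | ∀ F, VanishesOn X F →
    ∑ j, MvPolynomial.eval x.rep (MvPolynomial.pderiv j F) * v j = 0}
  zero_mem' := by
    intro F _
    simp
  add_mem' := by
    intro v w hv hw F hF
    simp only [Pi.add_apply, mul_add, Finset.sum_add_distrib, hv F hF, hw F hF, add_zero]
  smul_mem' := by
    intro c v hv F hF
    simp only [Pi.smul_apply, smul_eq_mul, mul_left_comm _ c, ← Finset.mul_sum, hv F hF, mul_zero]

/-- A point `H` of the dual projective space stands for the hyperplane
`∑ j, H_j X_j = 0`. This is the statement that the hyperplane contains `T_x X`. -/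
def IsTangentAt (X : Set (PSpace σ)) (H x : PSpace σ) : Prop :=
  ∀ v ∈ tangentSpace X x, ∑ j, H.rep j * v j = 0

/-- The linear system of hyperplanes containing `T_x X`. -/
def tangentHyperplanes (X : Set (PSpace σ)) (x : PSpace σ) : Set (PSpace σ) :=
  {H | IsTangentAt X H x}

/-- The locus of points of `X` at which the hyperplane `H` is tangent to `X`; if `X` is smooth
and not contained in `H`, this is the singular locus of the scheme `X ∩ H`. -/
def tangencyLocus (X : Set (PSpace σ)) (H : PSpace σ) : Set (PSpace σ) :=
  {y | y ∈ X ∧ IsTangentAt X H y}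

/-- The contact locus of `X` with respect to `x` and `H`: the closure of the union of the
irreducible components of the tangency locus of `H` that contain `x`. -/
def contactLocus (X : Set (PSpace σ)) (x H : PSpace σ) : Set (PSpace σ) :=
  closure (⋃₀ {Z | Maximal (fun W => IsIrreducible W ∧ W ⊆ tangencyLocus X H) Z ∧ x ∈ Z})

/-- `X` is `1`-weakly defective: for a general point `x` of `X` and a general hyperplane `H`
containing `T_x X`, the contact locus has positive dimension. -/
def IsOneWeaklyDefective (X : Set (PSpace σ)) : Prop :=
  ForGeneral X fun x => ForGeneral (tangentHyperplanes X x) fun H =>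
    0 < topologicalKrullDim (contactLocus X x H)

/-- Smooth points of an irreducible variety `X`: the points of `X` where the dimension of the
tangent space is the smallest one (which is the dimension of `X`). -/
def IsSmoothPoint (X : Set (PSpace σ)) (x : PSpace σ) : Prop :=
  x ∈ X ∧ ∀ y ∈ X, Module.finrank ℂ (tangentSpace X x) ≤ Module.finrank ℂ (tangentSpace X y)

/-- The dual variety: the Zariski closure, in the dual projective space, of the set of hyperplanes
that are tangent to `X` at some smooth point. -/
def dualVariety (X : Set (PSpace σ)) : Set (PSpace σ) :=
  closure {H | ∃ x, IsSmoothPoint X x ∧ IsTangentAt X H x}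

/-- A hypersurface: the zero locus of one nonzero homogeneous polynomial of positive degree. -/
def IsHypersurface (Z : Set (PSpace σ)) : Prop :=
  ∃ (F : MvPolynomial σ ℂ) (k : ℕ), 0 < k ∧ F ≠ 0 ∧ F.IsHomogeneous k ∧ Z = hypersurface F

end Projective

/-- Indices of the homogeneous coordinates of the ambient space, one for each monomial of
multidegree `d`: an index is a tuple of multisets `J i`, of size `d i`, of elements of
`{0, …, n i}`. -/
abbrev MultiIndex {r : ℕ} (n d : Fin r → ℕ) : Type :=
  (i : Fin r) → Sym (Fin (n i + 1)) (d i)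

/-- All monomials of multidegree `d`, evaluated at `x`. -/
def monomialVector {r : ℕ} (n d : Fin r → ℕ) (x : (i : Fin r) → Fin (n i + 1) → ℂ) :
    MultiIndex n d → ℂ :=
  fun J => ∏ i, ((J i : Multiset (Fin (n i + 1))).map (x i)).prod

theorem monomialVector_ne_zero {r : ℕ} (n d : Fin r → ℕ)
    (x : (i : Fin r) → Fin (n i + 1) → ℂ) (hx : ∀ i, x i ≠ 0) : monomialVector n d x ≠ 0 := by
  have h : ∀ i, ∃ k, x i k ≠ 0 := fun i => Function.ne_iff.mp (hx i)
  choose k hk using h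
  intro h0
  have h1 := congrFun h0 fun i => Sym.replicate (d i) (k i)
  simp only [monomialVector, Sym.coe_replicate, Multiset.map_replicate, Multiset.prod_replicate,
    Pi.zero_apply] at h1
  exact Finset.prod_ne_zero_iff.mpr (fun i _ => pow_ne_zero (d i) (hk i)) h1

/-- The morphism from `ℙ^{n_1} × ⋯ × ℙ^{n_r}` given by the complete linear system
`|O(d_1, …, d_r)|`, in the monomial basis. -/
def embedding {r : ℕ} (n d : Fin r → ℕ) (x : (i : Fin r) → PSpace (Fin (n i + 1))) :
    PSpace (MultiIndex n d) :=
  Projectivization.mk ℂ (monomialVector n d fun i => (x i).rep)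
    (monomialVector_ne_zero n d _ fun i => (x i).rep_nonzero)

/-- The Segre-Veronese variety. -/
def segreVeronese {r : ℕ} (n d : Fin r → ℕ) : Set (PSpace (MultiIndex n d)) :=
  Set.range (embedding n d)

end SegreVeronese

end

/-! A hyperplane is a form f of multidegree d, and it is tangent to the variety at a point exactly
when f is singular there (`forall_mem_tangentSpace_iff`). Both claims are therefore statements about
singular forms.

Suppose d_r = 1 and n_r > n_1 + … + n_{r-1}. Then f = ∑ a_j z_j is linear in the last factor. It is
singular at a point iff all a_j vanish there and so do the derivatives along the other factors; the
latter are ∑_{i<r} n_i linear conditions on z. The last factor has more affine coordinates than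
that, so singular points come in lines (`exists_line_isSingularAt`). Moreover, n_r + 1 equations a_j
= 0 in only ∑_{i<r} n_i parameters force codimension at least two: singular forms satisfy an
equation that avoids any prescribed coefficient (`exists_equation_without_variable`), which the
Nullstellensatz rules out for a hypersurface.

Otherwise, each factor with d_i = 1 has n_i at most half of T = ∑ n_j. The cyclic shift s of all
affine coordinates by ⌊T/2⌋ then moves every coordinate of such a factor out of it, so ∑ x_u
x_{s(u)} is an admissible form, and its Hessian is invertible (`exists_hessian_ne_zero`). Hence a
general form singular at a given point has a nondegenerate, isolated singularity there
(`subset_singleton_of_hessian_ne_zero`), and the variety is not 1-weakly defective. The ideal of the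
dual cone is prime, being the kernel of a parametrization, and nonzero by a parameter count. It
contains no nonzero polynomial free of the constant coefficient: differentiating such a relation and
inverting the Hessian puts all its partial derivatives back into the ideal (`pderiv_mem_dualIdeal`),
and the degree drops to zero. A prime ideal of this kind is principal (`exists_prime_eq_span`), and
its generator is homogeneous. -/

noncomputable section

namespace SegreVeronese

/-! ### Polynomial algebra: dual numbers, homogeneous components, principal prime ideals. -/

section Polynomials

open MvPolynomial

variable {σ τ : Type*}

theorem eval_aeval (Φ : σ → MvPolynomial τ ℂ) (y : τ → ℂ) (F : MvPolynomial σ ℂ) :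
    eval y (aeval Φ F) = eval (fun j => eval y (Φ j)) F := by
  have := comp_aeval_apply (f := Φ) (φ := (aeval y : MvPolynomial τ ℂ →ₐ[ℂ] ℂ)) F
  rwa [aeval_eq_eval, aeval_eq_eval] at this

/-- The chain rule for partial derivatives of polynomials. -/
theorem pderiv_aeval [Fintype σ] (Φ : σ → MvPolynomial τ ℂ) (t : τ) (F : MvPolynomial σ ℂ) :
    pderiv t (aeval Φ F) = ∑ j, aeval Φ (pderiv j F) * pderiv t (Φ j) := by
  classical
  induction F using MvPolynomial.induction_on with
  | C a => simp
  | add p q hp hq => simp only [map_add, hp, hq, add_mul, Finset.sum_add_distrib]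
  | mul_X p i hp =>
    simp only [map_mul, aeval_X, Derivation.leibniz, pderiv_X, smul_eq_mul, hp, map_add, add_mul,
      Finset.sum_add_distrib, Finset.mul_sum]
    congr 1
    · rw [Finset.sum_eq_single i]
      · simp
      · intro b _ hb
        simp [Pi.single_eq_of_ne (Ne.symm hb)]
      · simp
    · exact Finset.sum_congr rfl fun j _ => by ring

/-- Evaluation of a polynomial over the dual numbers. -/
theorem aeval_dualNumber [Fintype σ] (x v : σ → ℂ) (F : MvPolynomial σ ℂ) :
    aeval (fun j => (TrivSqZeroExt.inl (x j) + TrivSqZeroExt.inr (v j) : DualNumber ℂ)) F =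
      TrivSqZeroExt.inl (eval x F) + TrivSqZeroExt.inr (∑ j, eval x (pderiv j F) * v j) := by
  classical
  induction F using MvPolynomial.induction_on with
  | C a =>
    simp [TrivSqZeroExt.algebraMap_eq_inl]
  | add p q hp hq =>
    simp only [map_add, hp, hq, TrivSqZeroExt.inl_add, add_mul, Finset.sum_add_distrib,
      TrivSqZeroExt.inr_add]
    abel
  | mul_X p i hp =>
    have h : ∑ j, eval x (pderiv j (p * X i)) * v j =
        eval x p * v i + x i * ∑ j, eval x (pderiv j p) * v j := by
      simp only [map_mul, Derivation.leibniz, pderiv_X, smul_eq_mul, map_add, add_mul,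
        Finset.sum_add_distrib, Finset.mul_sum, eval_X]
      congr 1
      · rw [Finset.sum_eq_single i]
        · simp
        · intro b _ hb
          simp [Pi.single_eq_of_ne (Ne.symm hb)]
        · simp
      · exact Finset.sum_congr rfl fun j _ => by ring
    rw [h, map_mul, hp, aeval_X]
    ext <;> simp [mul_comm]
    ring

/-- Homogeneous polynomials scale. -/
theorem aeval_mul_of_isHomogeneous {A : Type*} [CommRing A] [Algebra ℂ A] {k : ℕ}
    {F : MvPolynomial σ ℂ} (hF : F.IsHomogeneous k) (c : A) (x : σ → A) :
    aeval (fun j => c * x j) F = c ^ k * aeval x F := by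
  rw [aeval_def, aeval_def, eval₂_eq, eval₂_eq, Finset.mul_sum]
  refine Finset.sum_congr rfl fun m hm => ?_
  have hk : ∑ i ∈ m.support, m i = k := hF.degree_eq_sum_deg_support hm |>.symm
  simp only [mul_pow, Finset.prod_mul_distrib, Finset.prod_pow_eq_pow_sum, hk]
  ring

theorem eval_smul_of_isHomogeneous {k : ℕ}
    {F : MvPolynomial σ ℂ} (hF : F.IsHomogeneous k) (c : ℂ) (x : σ → ℂ) :
    eval (c • x) F = c ^ k * eval x F := by
  have := aeval_mul_of_isHomogeneous hF c x
  rwa [aeval_eq_eval, aeval_eq_eval] at this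

/-- First order expansion of a polynomial at a point. -/
theorem exists_first_order_expansion [Fintype σ] (y : σ → ℂ) (g : MvPolynomial σ ℂ) :
    ∃ q : σ → MvPolynomial σ ℂ, g = C (eval y g) + ∑ j, q j * (X j - C (y j)) ∧
      ∀ j, eval y (q j) = eval y (pderiv j g) := by
  classical
  have h : ∃ q : σ → MvPolynomial σ ℂ, g = C (eval y g) + ∑ j, q j * (X j - C (y j)) := by
    induction g using MvPolynomial.induction_on with
    | C a => exact ⟨0, by simp⟩
    | add p q hp hq =>
      obtain ⟨a, ha⟩ := hp
      obtain ⟨b, hb⟩ := hq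
      refine ⟨a + b, ?_⟩
      conv_lhs => rw [ha, hb]
      simp only [map_add, Pi.add_apply, add_mul, Finset.sum_add_distrib]
      ring
    | mul_X p i hp =>
      obtain ⟨a, ha⟩ := hp
      refine ⟨fun j => a j * X i + (if j = i then C (eval y p) else 0), ?_⟩
      simp only [add_mul, Finset.sum_add_distrib, ite_mul, zero_mul, Finset.sum_ite_eq',
        Finset.mem_univ, if_true]
      have : ∑ j, a j * X i * (X j - C (y j)) = (∑ j, a j * (X j - C (y j))) * X i := by
        rw [Finset.sum_mul]
        exact Finset.sum_congr rfl fun j _ => by ring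
      rw [this]
      conv_lhs => rw [ha]
      simp only [map_mul, eval_X]
      ring
  obtain ⟨q, hq⟩ := h
  refine ⟨q, hq, fun i => ?_⟩
  conv_rhs => rw [hq]
  simp only [map_add, pderiv_C, map_sum, Derivation.leibniz, smul_eq_mul, map_sub, pderiv_X,
    map_mul, eval_X, eval_C, sub_self, zero_mul, add_zero, zero_add, sub_zero]
  rw [Finset.sum_eq_single i]
  · simp
  · intro b _ hb
    simp [Pi.single_eq_of_ne hb]
  · simp

/-- More polynomials than variables satisfy an algebraic relation. -/
theorem exists_algebraic_relation {σ τ : Type} [Fintype σ] [Fintype τ]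
    (h : Fintype.card τ < Fintype.card σ)
    (g : σ → MvPolynomial τ ℂ) : ∃ R : MvPolynomial σ ℂ, R ≠ 0 ∧ aeval g R = 0 := by
  by_contra hcon
  push Not at hcon
  have hind : AlgebraicIndependent ℂ g := by
    rw [algebraicIndependent_iff]
    intro p hp
    by_contra hp0
    exact hcon p hp0 hp
  have h1 := hind.cardinalMk_le_trdeg
  rw [MvPolynomial.trdeg_of_isDomain] at h1
  simp at h1
  omega

theorem pderiv_pderiv_comm (i j : σ) (R : MvPolynomial σ ℂ) :
    pderiv i (pderiv j R) = pderiv j (pderiv i R) := by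
  classical
  have h : ⁅pderiv (R := ℂ) i, pderiv (R := ℂ) j⁆ = 0 := by
    refine derivation_ext fun x => ?_
    rw [Derivation.commutator_apply, pderiv_X, pderiv_X]
    simp only [Pi.single_apply]
    split_ifs <;> simp
  have h1 := congrArg (fun D => D R) h
  simp only [Derivation.commutator_apply] at h1
  exact sub_eq_zero.mp h1

theorem totalDegree_pderiv_lt {j : σ} {R : MvPolynomial σ ℂ} (h : pderiv j R ≠ 0) :
    (pderiv j R).totalDegree < R.totalDegree := by
  classical
  have key : ∀ m ∈ (pderiv j R).support, (m.sum fun _ e => e) + 1 ≤ R.totalDegree := by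
    intro m hm
    rw [mem_support_iff, coeff_pderiv] at hm
    have h2 : m + Finsupp.single j 1 ∈ R.support := by
      rw [mem_support_iff]
      intro h0
      simp [h0] at hm
    have h3 := le_totalDegree h2
    rw [Finsupp.sum_add_index' (fun _ => rfl) (fun _ _ _ => rfl)] at h3
    simpa using h3
  obtain ⟨m, hm⟩ := support_nonempty.mpr h
  have := key m hm
  rw [totalDegree, Finset.sup_lt_iff (by simp; omega)]
  intro m hm
  have := key m hm
  omega

/-- Characteristic zero enters here: the coefficient at m reappears in `pderiv j R` multiplied by
the integer m j, which is nonzero for some j. -/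
theorem eq_C_of_pderiv_eq_zero {R : MvPolynomial σ ℂ} (h : ∀ j, pderiv j R = 0) :
    R = C (coeff 0 R) := by
  classical
  ext m
  rw [coeff_C]
  split_ifs with hm
  · rw [hm]
  · obtain ⟨j, hj⟩ : ∃ j, m j ≠ 0 := by
      by_contra hcon
      push Not at hcon
      exact hm (Finsupp.ext fun j => by simp [hcon j])
    have h1 := congrArg (coeff (m - Finsupp.single j 1)) (h j)
    have h2 : m - Finsupp.single j 1 + Finsupp.single j 1 = m := by
      apply tsub_add_cancel_of_le
      simpa [Finsupp.single_le_iff] using Nat.one_le_iff_ne_zero.mpr hj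
    rw [coeff_pderiv, h2, coeff_zero, mul_eq_zero] at h1
    rcases h1 with h1 | h1
    · exact h1
    · exfalso
      have h4 : ((((m - Finsupp.single j 1 : σ →₀ ℕ) j + 1 : ℕ)) : ℂ) = 0 := by
        push_cast
        exact h1
      exact absurd (Nat.cast_eq_zero.mp h4) (by omega)

/-- If a polynomial vanishes on a line through the origin, so do its homogeneous components. -/
theorem eval_homogeneousComponent_eq_zero {R : MvPolynomial σ ℂ} {x : σ → ℂ}
    (h : ∀ c : ℂ, eval (c • x) R = 0) (k : ℕ) : eval x (homogeneousComponent k R) = 0 := by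
  -- The values of the homogeneous components at x are the coefficients of R(c x) as a polynomial in
  -- c.
  set p : Polynomial ℂ := ∑ i ∈ Finset.range (R.totalDegree + 1),
    Polynomial.monomial i (eval x (homogeneousComponent i R)) with hp
  have hp0 : p = 0 := by
    apply Polynomial.funext
    intro c
    rw [Polynomial.eval_zero, ← h c]
    conv_rhs => rw [← sum_homogeneousComponent R]
    rw [hp, Polynomial.eval_finsetSum, map_sum]
    refine Finset.sum_congr rfl fun i _ => ?_
    rw [eval_smul_of_isHomogeneous (homogeneousComponent_isHomogeneous i R),
      Polynomial.eval_monomial, mul_comm]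
  by_cases hk : k < R.totalDegree + 1
  · have := congrArg (fun q => Polynomial.coeff q k) hp0
    simpa [hp, Polynomial.coeff_monomial, hk] using this
  · rw [homogeneousComponent_eq_zero _ _ (by omega), map_zero]

theorem exists_homogeneousComponent_ne_zero {R : MvPolynomial σ ℂ} (h : R ≠ 0) :
    ∃ k, homogeneousComponent k R ≠ 0 := by
  by_contra hcon
  push Not at hcon
  apply h
  rw [← sum_homogeneousComponent R]
  exact Finset.sum_eq_zero fun i _ => hcon i

/-- A polynomial that divides all of its homogeneous components is homogeneous. -/
theorem isHomogeneous_of_dvd_homogeneousComponent {F : MvPolynomial σ ℂ} (h0 : F ≠ 0)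
    (h : ∀ k, F ∣ homogeneousComponent k F) : F.IsHomogeneous F.totalDegree := by
  obtain ⟨k, hk⟩ := exists_homogeneousComponent_ne_zero h0
  have hall : ∀ k, homogeneousComponent k F ≠ 0 → k = F.totalDegree := by
    intro k hk
    obtain ⟨G, hG⟩ := h k
    have hG0 : G ≠ 0 := by
      rintro rfl
      exact hk (by simpa using hG)
    -- A nonzero multiple of F has degree at least that of F, so only the top component can be
    -- nonzero.
    have h1 := totalDegree_mul_of_isDomain h0 hG0
    rw [← hG, (homogeneousComponent_isHomogeneous k F).totalDegree hk] at h1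
    have h2 : k ≤ F.totalDegree := by
      by_contra hcon
      exact hk (homogeneousComponent_eq_zero _ _ (by omega))
    omega
  have h3 : F = homogeneousComponent F.totalDegree F := by
    conv_lhs => rw [← sum_homogeneousComponent F]
    rw [Finset.sum_eq_single F.totalDegree]
    · intro b _ hb
      by_contra hcon
      exact hb (hall b hcon)
    · simp
  rw [h3]
  convert homogeneousComponent_isHomogeneous F.totalDegree F using 1
  rw [← h3]

/-- A nonzero prime ideal of polynomials in one variable over a factorial domain that contains no
nonzero constants is principal. -/
theorem exists_prime_eq_span_polynomial {A : Type*} [CommRing A] [IsDomain A]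
    [UniqueFactorizationMonoid A] (I : Ideal (Polynomial A)) [hI : I.IsPrime] (h0 : I ≠ ⊥)
    (hc : ∀ a : A, Polynomial.C a ∈ I → a = 0) : ∃ F, Prime F ∧ I = Ideal.span {F} := by
  classical
  obtain ⟨G, hGI, hG0⟩ := Submodule.exists_mem_ne_zero_of_ne_bot h0
  have hex : ∃ n, ∃ F ∈ I, F ≠ 0 ∧ F.natDegree = n := ⟨_, G, hGI, hG0, rfl⟩
  obtain ⟨F, hFI, hF0, hFn⟩ := Nat.find_spec hex
  have hmin : ∀ G ∈ I, G ≠ 0 → Nat.find hex ≤ G.natDegree :=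
    fun G hG hG0 => Nat.find_min' hex ⟨G, hG, hG0, rfl⟩
  -- An element of minimal degree need not be prime, but one of its prime factors lies in the prime
  -- ideal and still has minimal degree.
  obtain ⟨f, hf, hfac⟩ := UniqueFactorizationMonoid.exists_prime_factors F hF0
  obtain ⟨P, hPf, hPI⟩ : ∃ P ∈ f, P ∈ I := by
    rw [← hI.multiset_prod_mem_iff_exists_mem]
    exact Ideal.mem_of_dvd I hfac.symm.dvd hFI
  have hPp : Prime P := hf P hPf
  have hP0 := hPp.ne_zero
  have hPF : P ∣ F := (Multiset.dvd_prod hPf).trans hfac.dvd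
  have hPmin : ∀ G ∈ I, G ≠ 0 → P.natDegree ≤ G.natDegree := fun G hG hG0 =>
    (Polynomial.natDegree_le_of_dvd hPF hF0).trans (hFn.le.trans (hmin G hG hG0))
  have hPpos : 0 < P.natDegree := by
    rw [Nat.pos_iff_ne_zero]
    intro hP
    rw [Polynomial.eq_C_of_natDegree_eq_zero hP] at hPI hP0
    exact hP0 (by rw [hc _ hPI, Polynomial.C_0])
  have hdvd : ∀ n, ∀ G ∈ I, G.natDegree ≤ n → P ∣ G := by
    intro n
    induction n with
    | zero =>
      intro G hG hn
      by_contra hcon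
      have := hPmin G hG (fun h => hcon (h ▸ dvd_zero P))
      omega
    | succ n ih =>
      intro G hG hn
      by_cases hG0 : G = 0
      · rw [hG0]
        exact dvd_zero P
      have hle := hPmin G hG hG0
      -- Pseudo-division: G is multiplied by the leading coefficient of P before the leading terms
      -- cancel. Afterwards P, being prime of positive degree, cannot divide that constant and so
      -- divides G.
      have hlt := Polynomial.natDegree_cancelLeads_lt_of_natDegree_le_natDegree hle
        (by omega)
      have hmem : P.cancelLeads G ∈ I :=
        I.sub_mem (I.mul_mem_left _ hG) (I.mul_mem_left _ hPI)
      have h1 : P ∣ P.cancelLeads G := ih _ hmem (by omega)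
      rw [Polynomial.cancelLeads, dvd_sub_left (dvd_mul_left _ _), Nat.sub_eq_zero_of_le hle,
        pow_zero, mul_one] at h1
      rcases hPp.dvd_or_dvd h1 with h2 | h2
      · have h3 := Polynomial.natDegree_le_of_dvd h2
          (by simpa using hP0)
        rw [Polynomial.natDegree_C] at h3
        omega
      · exact h2
  refine ⟨P, hPp, le_antisymm (fun G hG => Ideal.mem_span_singleton.mpr
    (hdvd _ G hG le_rfl)) ?_⟩
  rw [Ideal.span_singleton_le_iff_mem]
  exact hPI

/-- A nonzero prime ideal of polynomials that contains no nonzero polynomial free of the variable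
`j` is principal. -/
theorem exists_prime_eq_span (j : σ) (I : Ideal (MvPolynomial σ ℂ)) [hI : I.IsPrime]
    (h0 : I ≠ ⊥) (hc : ∀ a : MvPolynomial {x : σ // x ≠ j} ℂ, rename Subtype.val a ∈ I → a = 0) :
    ∃ F, Prime F ∧ I = Ideal.span {F} := by
  classical
  -- View polynomials as polynomials in the variable j over the factorial ring in the other
  -- variables.
  let e : Polynomial (MvPolynomial {x : σ // x ≠ j} ℂ) ≃ₐ[ℂ] MvPolynomial σ ℂ :=
    (optionEquivLeft ℂ {x : σ // x ≠ j}).symm.trans (renameEquiv ℂ (Equiv.optionSubtypeNe j))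
  have heC : ∀ a, e (Polynomial.C a) = rename Subtype.val a := by
    intro a
    induction a using MvPolynomial.induction_on with
    | C a => simp [e, optionEquivLeft_symm_C_C]
    | add p q hp hq => simp [hp, hq]
    | mul_X p i hp =>
      rw [map_mul, map_mul, hp, map_mul, rename_X]
      congr 1
      simp [e, optionEquivLeft_symm_C_X]
  have hbij : Function.Bijective e := e.bijective
  have hI' : (I.comap e).IsPrime := Ideal.comap_isPrime e I
  obtain ⟨F, hF, hFI⟩ := exists_prime_eq_span_polynomial (I.comap e)
    (by
      intro hbot
      apply h0
      rw [eq_bot_iff]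
      intro G hG
      have : e.symm G ∈ I.comap e := by simpa [Ideal.mem_comap] using hG
      rw [hbot, Ideal.mem_bot] at this
      simpa using this)
    (fun a ha => hc a (by rw [← heC]; exact ha))
  refine ⟨e F, (MulEquiv.prime_iff e.toMulEquiv).mpr hF, ?_⟩
  ext G
  have : G ∈ I ↔ e.symm G ∈ I.comap e := by simp [Ideal.mem_comap]
  rw [this, hFI, Ideal.mem_span_singleton, Ideal.mem_span_singleton]
  constructor
  · rintro ⟨Q, hQ⟩
    exact ⟨e Q, by rw [← map_mul, ← hQ, AlgEquiv.apply_symm_apply]⟩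
  · rintro ⟨Q, hQ⟩
    exact ⟨e.symm Q, by rw [hQ, map_mul, AlgEquiv.symm_apply_apply]⟩

end Polynomials

/-! ### The Zariski topology, irreducible curves and positive dimension. -/

section ZariskiTopology

open MvPolynomial

variable {σ : Type}

theorem isClosed_iff_isAlgebraic {Z : Set (PSpace σ)} : IsClosed Z ↔ IsAlgebraic Z := by
  rw [← isOpen_compl_iff]
  change Zᶜᶜ ∈ {Z | IsAlgebraic Z} ↔ _
  rw [compl_compl, Set.mem_ofPred_eq]

theorem exists_rep_mk (v : σ → ℂ) (hv : v ≠ 0) :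
    ∃ c : ℂ, c ≠ 0 ∧ (Projectivization.mk ℂ v hv).rep = c • v := by
  obtain ⟨a, ha⟩ := Projectivization.exists_smul_eq_mk_rep ℂ v hv
  exact ⟨a, a.ne_zero, ha.symm⟩

theorem eval_rep_mk_eq_zero_iff {F : MvPolynomial σ ℂ} {k : ℕ} (hF : F.IsHomogeneous k)
    (v : σ → ℂ) (hv : v ≠ 0) :
    eval (Projectivization.mk ℂ v hv).rep F = 0 ↔ eval v F = 0 := by
  obtain ⟨c, hc, h⟩ := exists_rep_mk v hv
  rw [h, eval_smul_of_isHomogeneous hF, mul_eq_zero]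
  simp [hc]

theorem isClosed_setOf_eval_eq_zero {F : MvPolynomial σ ℂ} {k : ℕ} (hF : F.IsHomogeneous k) :
    IsClosed {p : PSpace σ | eval p.rep F = 0} := by
  rw [isClosed_iff_isAlgebraic]
  exact ⟨{F}, by rintro G rfl; exact ⟨k, hF⟩, by ext p; simp [zeroLocus]⟩

theorem mem_closure_iff_forall_eval {A : Set (PSpace σ)} {p : PSpace σ} :
    p ∈ closure A ↔ ∀ (F : MvPolynomial σ ℂ) (k : ℕ), F.IsHomogeneous k →
      (∀ q ∈ A, eval q.rep F = 0) → eval p.rep F = 0 := by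
  constructor
  · intro hp F k hF hA
    exact closure_minimal (t := {p : PSpace σ | eval p.rep F = 0}) hA
      (isClosed_setOf_eval_eq_zero hF) hp
  · intro h
    obtain ⟨S, hS, hcl⟩ := isClosed_iff_isAlgebraic.mp (isClosed_closure (s := A))
    rw [hcl]
    intro F hF
    obtain ⟨k, hk⟩ := hS F hF
    refine h F k hk fun q hq => ?_
    have : q ∈ zeroLocus S := hcl ▸ subset_closure hq
    exact this F hF

/-- A point x is cut out by the 2×2 minors of the pair (x, p). -/
instance : T1Space (PSpace σ) where
  t1 x := by
    rw [isClosed_iff_isAlgebraic]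
    refine ⟨{F | ∃ i j, F = C (x.rep i) * X j - C (x.rep j) * X i}, ?_, ?_⟩
    · rintro F ⟨i, j, rfl⟩
      exact ⟨1, (isHomogeneous_C_mul_X _ _).sub (isHomogeneous_C_mul_X _ _)⟩
    · ext p
      constructor
      · rintro rfl F ⟨i, j, rfl⟩
        simp [mul_comm]
      · intro hp
        obtain ⟨i, hi⟩ := Function.ne_iff.mp x.rep_nonzero
        rw [Set.mem_singleton_iff, ← p.mk_rep, ← x.mk_rep, Projectivization.mk_eq_mk_iff']
        refine ⟨p.rep i / x.rep i, funext fun j => ?_⟩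
        have := hp _ ⟨i, j, rfl⟩
        simp only [map_sub, map_mul, eval_C, eval_X] at this
        simp only [Pi.zero_apply] at hi
        simp only [Pi.smul_apply, smul_eq_mul]
        field_simp
        linear_combination -this

/-- A set given by a polynomial equation in an affine chart becomes closed after adding the
hyperplane at infinity. -/
theorem isClosed_chart_zero {τ : Type} (K : σ) (L : τ → σ) (e : MvPolynomial τ ℂ) :
    IsClosed {p : PSpace σ | p.rep K = 0 ∨ eval (fun t => p.rep (L t) / p.rep K) e = 0} := by
  classical
  -- The homogenization of e with respect to the coordinate K, times one more factor X K that adds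
  -- the hyperplane at infinity.
  let E : MvPolynomial σ ℂ := X K * ∑ m ∈ e.support,
    C (coeff m e) * (X K ^ (e.totalDegree - m.degree) * ∏ t ∈ m.support, X (L t) ^ m t)
  have hE : E.IsHomogeneous (1 + e.totalDegree) := by
    refine (isHomogeneous_X ℂ K).mul (IsHomogeneous.sum _ _ _ fun m hm => ?_)
    have hle : m.degree ≤ e.totalDegree := le_totalDegree hm
    have h1 : (∏ t ∈ m.support, (X (L t) : MvPolynomial σ ℂ) ^ m t).IsHomogeneous m.degree :=
      IsHomogeneous.prod _ _ _ fun t _ => isHomogeneous_X_pow _ _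
    have h2 := ((isHomogeneous_X_pow (R := ℂ) K (e.totalDegree - m.degree)).mul h1).C_mul
      (coeff m e)
    rwa [Nat.sub_add_cancel hle] at h2
  have heval : ∀ v : σ → ℂ, v K ≠ 0 →
      eval v E = v K ^ (1 + e.totalDegree) * eval (fun t => v (L t) / v K) e := by
    intro v hv
    simp only [E, map_mul, eval_X, map_sum, eval_C, map_pow, map_prod, pow_add, pow_one]
    rw [eval_eq, mul_assoc, Finset.mul_sum (s := e.support) (a := v K ^ _)]
    congr 1
    refine Finset.sum_congr rfl fun m hm => ?_
    have hle : m.degree ≤ e.totalDegree := le_totalDegree hm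
    have h3 : ∏ t ∈ m.support, (v (L t) / v K) ^ m t =
        (∏ t ∈ m.support, v (L t) ^ m t) / v K ^ m.degree := by
      simp only [div_pow, Finset.prod_div_distrib, Finset.prod_pow_eq_pow_sum]
      rfl
    rw [h3, ← Nat.sub_add_cancel hle, pow_add, Nat.add_sub_cancel]
    field_simp
  convert isClosed_setOf_eval_eq_zero hE using 1
  ext p
  simp only [Set.mem_ofPred_eq]
  by_cases hp : p.rep K = 0
  · simp [hp, E]
  · rw [heval _ hp, mul_eq_zero]
    simp [hp]

/-- The image of the affine line under a polynomial parametrization is irreducible. -/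
theorem isIrreducible_range_curve (γ : σ → Polynomial ℂ) (f : ℂ → PSpace σ)
    (hf : ∀ t, ∃ c : ℂ, c ≠ 0 ∧ (f t).rep = c • fun j => (γ j).eval t) :
    IsIrreducible (Set.range f) := by
  refine ⟨Set.range_nonempty f, ?_⟩
  rw [isPreirreducible_iff_isClosed_union_isClosed]
  intro Z₁ Z₂ h₁ h₂ hsub
  by_contra hcon
  push Not at hcon
  -- A homogeneous equation of Z that fails somewhere on the curve pulls back to a nonzero
  -- polynomial in the parameter; two such polynomials have a nonzero product.
  have key : ∀ Z : Set (PSpace σ), IsClosed Z → ¬ Set.range f ⊆ Z →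
      ∃ p : Polynomial ℂ, p ≠ 0 ∧ ∀ t, f t ∈ Z → p.eval t = 0 := by
    intro Z hZ hn
    rw [isClosed_iff_isAlgebraic] at hZ
    obtain ⟨S, hS, rfl⟩ := hZ
    obtain ⟨_, ⟨t₀, rfl⟩, ht₀⟩ := Set.not_subset.mp hn
    simp only [zeroLocus, Set.mem_ofPred_eq, not_forall] at ht₀
    obtain ⟨F, hFS, hF⟩ := ht₀
    obtain ⟨k, hk⟩ := hS F hFS
    have heval : ∀ t, (aeval γ F : Polynomial ℂ).eval t = eval (fun j => (γ j).eval t) F := by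
      intro t
      have := map_aeval γ (Polynomial.evalRingHom t) F
      simp only [Polynomial.coe_evalRingHom] at this
      rw [this, eval]
      congr 2
      ext; simp
    have hz : ∀ t, eval (f t).rep F = 0 ↔ (aeval γ F : Polynomial ℂ).eval t = 0 := by
      intro t
      obtain ⟨c, hc, h⟩ := hf t
      rw [h, eval_smul_of_isHomogeneous hk, heval, mul_eq_zero]
      simp [hc]
    refine ⟨aeval γ F, ?_, fun t ht => (hz t).mp (ht F hFS)⟩
    intro h0
    exact hF ((hz t₀).mpr (by rw [h0, Polynomial.eval_zero]))
  obtain ⟨p, hp, hp'⟩ := key Z₁ h₁ hcon.1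
  obtain ⟨q, hq, hq'⟩ := key Z₂ h₂ hcon.2
  apply mul_ne_zero hp hq
  apply Polynomial.funext
  intro t
  rw [Polynomial.eval_mul, Polynomial.eval_zero]
  rcases hsub ⟨t, rfl⟩ with h | h
  · rw [hp' t h, zero_mul]
  · rw [hq' t h, mul_zero]

/-- The chain from a point x to the closure of ℓ in S is strict. -/
theorem topologicalKrullDim_pos {X : Type*} [TopologicalSpace X] [T1Space X] {S ℓ : Set X}
    (hℓ : IsIrreducible ℓ) (hS : ℓ ⊆ S) (hnt : ℓ.Nontrivial) : 0 < topologicalKrullDim S := by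
  obtain ⟨x, hx, y, hy, hxy⟩ := hnt
  rw [topologicalKrullDim, Order.krullDim_pos_iff]
  have hirr : IsIrreducible (Subtype.val ⁻¹' ℓ : Set S) := by
    refine ⟨⟨⟨x, hS hx⟩, hx⟩, ?_⟩
    rintro _ _ ⟨u, hu, rfl⟩ ⟨v, hv, rfl⟩ ⟨a, ha, hau⟩ ⟨b, hb, hbv⟩
    obtain ⟨w, hw, hwuv⟩ := hℓ.2 u v hu hv ⟨a, ha, hau⟩ ⟨b, hb, hbv⟩
    exact ⟨⟨w, hS hw⟩, hw, hwuv⟩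
  refine ⟨⟨{⟨x, hS hx⟩}, isIrreducible_singleton, isClosed_singleton⟩,
    ⟨closure (Subtype.val ⁻¹' ℓ), hirr.closure, isClosed_closure⟩, lt_of_le_of_ne ?_ ?_⟩
  · rintro _ rfl
    exact subset_closure hx
  · intro h
    have h1 : (⟨y, hS hy⟩ : S) ∈ closure (Subtype.val ⁻¹' ℓ : Set S) := subset_closure hy
    have h2 := congrArg (fun A : TopologicalSpace.IrreducibleCloseds S => (A : Set S)) h
    simp only [TopologicalSpace.IrreducibleCloseds.coe_mk] at h2
    rw [← h2, Set.mem_singleton_iff, Subtype.mk.injEq] at h1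
    exact hxy h1.symm

theorem topologicalKrullDim_not_pos {X : Type*} [TopologicalSpace X] {S : Set X}
    (hS : S.Subsingleton) : ¬ 0 < topologicalKrullDim S := by
  have : Subsingleton S := hS.coe_sort
  rw [topologicalKrullDim, Order.krullDim_pos_iff]
  rintro ⟨A, B, hAB⟩
  obtain ⟨a, ha⟩ := A.isIrreducible.nonempty
  exact hAB.not_ge fun b _ => Subsingleton.elim a b ▸ ha

end ZariskiTopology

/-! ### Dimension of contact loci. -/

section ContactLocus

variable {σ : Type} [Fintype σ]

/-- By Zorn's lemma ℓ extends to a maximal irreducible subset of the tangency locus. It contains x,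
so it is part of the contact locus. -/
theorem topologicalKrullDim_contactLocus_pos {X ℓ : Set (PSpace σ)} {x H : PSpace σ}
    (hℓ : IsIrreducible ℓ) (hsub : ℓ ⊆ tangencyLocus X H) (hx : x ∈ ℓ) (hnt : ℓ.Nontrivial) :
    0 < topologicalKrullDim (contactLocus X x H) := by
  obtain ⟨Z, hZℓ, hZ⟩ := zorn_subset_nonempty {W | IsIrreducible W ∧ W ⊆ tangencyLocus X H}
    (by
      intro c hc hchain hne
      refine ⟨⋃₀ c, ⟨⟨?_, ?_⟩, Set.sUnion_subset fun W hW => (hc hW).2⟩,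
        fun W hW => Set.subset_sUnion_of_mem hW⟩
      · obtain ⟨W, hW⟩ := hne
        obtain ⟨w, hw⟩ := (hc hW).1.nonempty
        exact ⟨w, W, hW, hw⟩
      · rintro u v hu hv ⟨y, ⟨p, hpc, hyp⟩, hyu⟩ ⟨z, ⟨q, hqc, hzq⟩, hzv⟩
        rcases hchain.total hpc hqc with hpq | hqp
        · obtain ⟨w, hw, hwu⟩ := (hc hqc).1.2 u v hu hv ⟨y, hpq hyp, hyu⟩ ⟨z, hzq, hzv⟩
          exact ⟨w, ⟨q, hqc, hw⟩, hwu⟩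
        · obtain ⟨w, hw, hwu⟩ := (hc hpc).1.2 u v hu hv ⟨y, hyp, hyu⟩ ⟨z, hqp hzq, hzv⟩
          exact ⟨w, ⟨p, hpc, hw⟩, hwu⟩) ℓ ⟨hℓ, hsub⟩
  refine topologicalKrullDim_pos hℓ ?_ hnt
  refine hZℓ.trans (subset_trans ?_ subset_closure)
  exact Set.subset_sUnion_of_mem ⟨hZ, hZℓ hx⟩

theorem topologicalKrullDim_contactLocus_not_pos {X : Set (PSpace σ)} {x H : PSpace σ}
    (h : ∀ W, IsIrreducible W → W ⊆ tangencyLocus X H → x ∈ W → W ⊆ {x}) :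
    ¬ 0 < topologicalKrullDim (contactLocus X x H) := by
  apply topologicalKrullDim_not_pos
  refine (Set.subsingleton_singleton (a := x)).anti ?_
  refine closure_minimal (Set.sUnion_subset ?_) isClosed_singleton
  rintro W ⟨hW, hxW⟩
  exact h W hW.1.1 hW.1.2 hxW

end ContactLocus

/-! ### Affine charts and monomials. -/

section Charts

open MvPolynomial

variable {r : ℕ} {n d : Fin r → ℕ} {A B : Type*} [CommRing A] [CommRing B]

/-- Indices of the affine coordinates on a product of projective spaces. -/
abbrev AffineIndex {r : ℕ} (n : Fin r → ℕ) : Type := (i : Fin r) × Fin (n i)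

/-- The point with affine coordinates `y` in the chart where the coordinates `k i` are `1`. -/
def affinePoint (k : (i : Fin r) → Fin (n i + 1)) (y : AffineIndex n → A) (i : Fin r) :
    Fin (n i + 1) → A :=
  Fin.insertNth (α := fun _ => A) (k i) 1 fun b => y ⟨i, b⟩

@[simp]
theorem affinePoint_self (k : (i : Fin r) → Fin (n i + 1)) (y : AffineIndex n → A) (i : Fin r) :
    affinePoint k y i (k i) = 1 := by
  simp [affinePoint]

@[simp]
theorem affinePoint_succAbove (k : (i : Fin r) → Fin (n i + 1)) (y : AffineIndex n → A)
    (i : Fin r) (b : Fin (n i)) : affinePoint k y i ((k i).succAbove b) = y ⟨i, b⟩ := by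
  simp [affinePoint]

theorem map_affinePoint (f : A →+* B) (k : (i : Fin r) → Fin (n i + 1)) (y : AffineIndex n → A)
    (i : Fin r) (a : Fin (n i + 1)) :
    f (affinePoint k y i a) = affinePoint k (fun u => f (y u)) i a := by
  cases a using (k i).succAboveCases <;> simp

/-- The monomial with exponent `J`, evaluated at a point with coordinates in a ring. -/
def monomialEval (x : (i : Fin r) → Fin (n i + 1) → A) (J : MultiIndex n d) : A :=
  ∏ i, ((J i : Multiset (Fin (n i + 1))).map (x i)).prod

theorem monomialVector_eq (x : (i : Fin r) → Fin (n i + 1) → ℂ) (J : MultiIndex n d) :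
    monomialVector n d x J = monomialEval x J := rfl

theorem map_monomialEval (f : A →+* B) (x : (i : Fin r) → Fin (n i + 1) → A)
    (J : MultiIndex n d) : f (monomialEval x J) = monomialEval (fun i a => f (x i a)) J := by
  simp [monomialEval, map_prod, map_multiset_prod, Multiset.map_map]

theorem monomialEval_mul (c : Fin r → A) (x : (i : Fin r) → Fin (n i + 1) → A)
    (J : MultiIndex n d) :
    monomialEval (fun i a => c i * x i a) J = (∏ i, c i ^ d i) * monomialEval x J := by
  simp [monomialEval, Multiset.prod_map_mul, Finset.prod_mul_distrib]

/-- A monomial of multidegree `d` in the affine coordinates of a chart. -/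
def monomialPoly (k : (i : Fin r) → Fin (n i + 1)) (J : MultiIndex n d) :
    MvPolynomial (AffineIndex n) ℂ :=
  monomialEval (affinePoint k X) J

theorem aeval_monomialPoly [Algebra ℂ A] (k : (i : Fin r) → Fin (n i + 1)) (J : MultiIndex n d)
    (y : AffineIndex n → A) :
    aeval y (monomialPoly k J) = monomialEval (affinePoint k y) J := by
  have h1 := map_monomialEval ((aeval y : MvPolynomial (AffineIndex n) ℂ →ₐ[ℂ] A) :
    MvPolynomial (AffineIndex n) ℂ →+* A) (affinePoint k X) J
  have h2 : ∀ i a, ((aeval y : MvPolynomial (AffineIndex n) ℂ →ₐ[ℂ] A) :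
      MvPolynomial (AffineIndex n) ℂ →+* A) (affinePoint k X i a) = affinePoint k y i a := by
    intro i a
    rw [map_affinePoint]
    simp
  simp only [h2] at h1
  exact h1

theorem eval_monomialPoly (k : (i : Fin r) → Fin (n i + 1)) (J : MultiIndex n d)
    (y : AffineIndex n → ℂ) :
    eval y (monomialPoly k J) = monomialEval (affinePoint k y) J := by
  rw [← aeval_monomialPoly, aeval_eq_eval]

/-- The index of the monomial which is `1` on a chart. -/
def baseIndex (d : Fin r → ℕ) (k : (i : Fin r) → Fin (n i + 1)) : MultiIndex n d :=
  fun i => Sym.replicate (d i) (k i)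

/-- The index of the monomial which is an affine coordinate on a chart. -/
def coordIndex (hd : ∀ i, 0 < d i) (k : (i : Fin r) → Fin (n i + 1)) (u : AffineIndex n) :
    MultiIndex n d :=
  Function.update (baseIndex d k) u.1
    (Sym.mk ((k u.1).succAbove u.2 ::ₘ Multiset.replicate (d u.1 - 1) (k u.1)) (by
      have := hd u.1
      simp only [Multiset.card_cons, Multiset.card_replicate]
      omega))

/-- Since the replaced factor evaluates to 1, updating an index is a multiplication and needs no
division. Monomials are thus built from `baseIndex` one factor at a time. -/
theorem monomialEval_update (x : (i : Fin r) → Fin (n i + 1) → A) (J : MultiIndex n d)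
    (i : Fin r) (s : Sym (Fin (n i + 1)) (d i))
    (hJ : ((J i : Multiset (Fin (n i + 1))).map (x i)).prod = 1) :
    monomialEval x (Function.update J i s) =
      ((s : Multiset (Fin (n i + 1))).map (x i)).prod * monomialEval x J := by
  classical
  rw [monomialEval, monomialEval, ← Finset.mul_prod_erase _ _ (Finset.mem_univ i),
    ← Finset.mul_prod_erase Finset.univ
      (fun i => ((J i : Multiset (Fin (n i + 1))).map (x i)).prod) (Finset.mem_univ i),
    Function.update_self, hJ, one_mul]
  congr 1
  refine Finset.prod_congr rfl fun j hj => ?_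
  rw [Function.update_of_ne (Finset.ne_of_mem_erase hj)]

theorem prod_map_baseIndex (k : (i : Fin r) → Fin (n i + 1)) (y : AffineIndex n → A)
    (i : Fin r) :
    ((baseIndex d k i : Multiset (Fin (n i + 1))).map (affinePoint k y i)).prod = 1 := by
  simp [baseIndex, Sym.coe_replicate]

@[simp]
theorem monomialEval_baseIndex (k : (i : Fin r) → Fin (n i + 1)) (y : AffineIndex n → A) :
    monomialEval (affinePoint k y) (baseIndex d k) = 1 :=
  Finset.prod_eq_one fun i _ => prod_map_baseIndex k y i

@[simp]
theorem monomialEval_coordIndex (hd : ∀ i, 0 < d i) (k : (i : Fin r) → Fin (n i + 1))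
    (y : AffineIndex n → A) (u : AffineIndex n) :
    monomialEval (affinePoint k y) (coordIndex hd k u) = y u := by
  rw [coordIndex, monomialEval_update _ _ _ _ (prod_map_baseIndex k y _)]
  simp

@[simp]
theorem monomialPoly_baseIndex (k : (i : Fin r) → Fin (n i + 1)) :
    monomialPoly k (baseIndex d k) = 1 := monomialEval_baseIndex k _

@[simp]
theorem monomialPoly_coordIndex (hd : ∀ i, 0 < d i) (k : (i : Fin r) → Fin (n i + 1))
    (u : AffineIndex n) : monomialPoly k (coordIndex hd k u) = X u :=
  monomialEval_coordIndex hd k _ u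

theorem coordIndex_ne_baseIndex (hd : ∀ i, 0 < d i) (k : (i : Fin r) → Fin (n i + 1))
    (u : AffineIndex n) : coordIndex hd k u ≠ baseIndex d k := by
  intro h
  have := congrArg (fun J => eval (0 : AffineIndex n → ℂ) (monomialPoly k J)) h
  simp at this

/-- The product of two affine coordinates is a monomial of multidegree `d`, unless they belong to
the same factor and the degree there is `1`. -/
theorem exists_monomialPoly_eq_mul (hd : ∀ i, 0 < d i) (k : (i : Fin r) → Fin (n i + 1))
    (u v : AffineIndex n) (h : u.1 = v.1 → 2 ≤ d u.1) :
    ∃ J : MultiIndex n d, monomialPoly k J = X u * X v := by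
  by_cases huv : v.1 = u.1
  · obtain ⟨i, a⟩ := u
    obtain ⟨j, b⟩ := v
    obtain rfl : j = i := huv
    have h2 := h rfl
    refine ⟨Function.update (baseIndex d k) j
      (Sym.mk ((k j).succAbove a ::ₘ (k j).succAbove b ::ₘ
        Multiset.replicate (d j - 2) (k j)) ?_), ?_⟩
    · simp only [Multiset.card_cons, Multiset.card_replicate] at h2 ⊢
      omega
    · rw [monomialPoly, monomialEval_update _ _ _ _ (prod_map_baseIndex k _ _)]
      simp
  · refine ⟨Function.update (coordIndex hd k v) u.1 (coordIndex hd k u u.1), ?_⟩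
    have h1 : coordIndex hd k v u.1 = baseIndex d k u.1 := by
      rw [coordIndex, Function.update_of_ne (Ne.symm huv)]
    rw [monomialPoly, monomialEval_update _ _ _ _
      (by rw [h1]; exact prod_map_baseIndex k _ _), monomialEval_coordIndex]
    simp [coordIndex]

end Charts

/-! ### Points of the variety in charts. -/

section ChartPoints

open MvPolynomial

variable {r : ℕ} {n d : Fin r → ℕ}

theorem affinePoint_ne_zero (k : (i : Fin r) → Fin (n i + 1)) (y : AffineIndex n → ℂ)
    (i : Fin r) : affinePoint k y i ≠ 0 := by
  intro h
  have := congrFun h (k i)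
  simp at this

/-- The point of the Segre-Veronese variety with given affine coordinates in a chart. -/
def chartPoint (d : Fin r → ℕ) (k : (i : Fin r) → Fin (n i + 1)) (y : AffineIndex n → ℂ) :
    PSpace (MultiIndex n d) :=
  Projectivization.mk ℂ (monomialVector n d (affinePoint k y))
    (monomialVector_ne_zero n d _ (affinePoint_ne_zero k y))

theorem exists_rep_chartPoint (k : (i : Fin r) → Fin (n i + 1)) (y : AffineIndex n → ℂ) :
    ∃ c : ℂ, c ≠ 0 ∧
      ∀ J, (chartPoint d k y).rep J = c * eval y (monomialPoly k J) := by
  obtain ⟨c, hc, h⟩ := exists_rep_mk (monomialVector n d (affinePoint k y))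
    (monomialVector_ne_zero n d _ (affinePoint_ne_zero k y))
  refine ⟨c, hc, fun J => ?_⟩
  rw [chartPoint, h, eval_monomialPoly]
  rfl

theorem embedding_eq_chartPoint (k : (i : Fin r) → Fin (n i + 1)) (y : AffineIndex n → ℂ)
    (x : (i : Fin r) → PSpace (Fin (n i + 1))) (c : Fin r → ℂ)
    (h : ∀ i a, (x i).rep a = c i * affinePoint k y i a) :
    embedding n d x = chartPoint d k y := by
  rw [embedding, chartPoint, Projectivization.mk_eq_mk_iff']
  refine ⟨∏ i, c i ^ d i, funext fun J => ?_⟩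
  have : (fun i => (x i).rep) = fun i a => c i * affinePoint k y i a :=
    funext fun i => funext fun a => h i a
  rw [this]
  exact (monomialEval_mul c _ J).symm

theorem chartPoint_mem (k : (i : Fin r) → Fin (n i + 1)) (y : AffineIndex n → ℂ) :
    chartPoint d k y ∈ segreVeronese n d := by
  have h := fun i => exists_rep_mk (affinePoint k y i) (affinePoint_ne_zero k y i)
  choose c hc h using h
  refine ⟨fun i => Projectivization.mk ℂ (affinePoint k y i) (affinePoint_ne_zero k y i), ?_⟩
  exact embedding_eq_chartPoint k y _ c fun i a => by rw [h]; rfl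

theorem embedding_eq_chartPoint_of_ne_zero (k : (i : Fin r) → Fin (n i + 1))
    (x : (i : Fin r) → PSpace (Fin (n i + 1))) (h : ∀ i, (x i).rep (k i) ≠ 0) :
    embedding n d x = chartPoint d k
      fun u => (x u.1).rep ((k u.1).succAbove u.2) / (x u.1).rep (k u.1) := by
  refine embedding_eq_chartPoint k _ x (fun i => (x i).rep (k i)) fun i a => ?_
  have := h i
  cases a using (k i).succAboveCases with
  | x => simp
  | p b =>
    rw [affinePoint_succAbove]
    field_simp

theorem exists_eq_chartPoint {p : PSpace (MultiIndex n d)} (hp : p ∈ segreVeronese n d) :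
    ∃ k y, p = chartPoint d k y := by
  obtain ⟨x, rfl⟩ := hp
  have h : ∀ i, ∃ k, (x i).rep k ≠ 0 := fun i => Function.ne_iff.mp (x i).rep_nonzero
  choose k hk using h
  exact ⟨k, _, embedding_eq_chartPoint_of_ne_zero k x hk⟩

theorem exists_eq_chartPoint_of_rep_ne_zero (hd : ∀ i, 0 < d i)
    (k : (i : Fin r) → Fin (n i + 1)) {p : PSpace (MultiIndex n d)}
    (hp : p ∈ segreVeronese n d) (h : p.rep (baseIndex d k) ≠ 0) :
    ∃ y, p = chartPoint d k y := by
  obtain ⟨x, rfl⟩ := hp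
  refine ⟨_, embedding_eq_chartPoint_of_ne_zero k x fun i h0 => h ?_⟩
  obtain ⟨c, -, hc⟩ := exists_rep_mk (monomialVector n d fun i => (x i).rep)
    (monomialVector_ne_zero n d _ fun i => (x i).rep_nonzero)
  rw [embedding, hc, Pi.smul_apply, smul_eq_mul]
  apply mul_eq_zero_of_right
  refine Finset.prod_eq_zero (Finset.mem_univ i) ?_
  simp [baseIndex, Sym.coe_replicate, h0, (hd i).ne']

theorem rep_chartPoint_baseIndex_ne_zero (k : (i : Fin r) → Fin (n i + 1))
    (y : AffineIndex n → ℂ) : (chartPoint d k y).rep (baseIndex d k) ≠ 0 := by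
  obtain ⟨c, hc, h⟩ := exists_rep_chartPoint (d := d) k y
  rw [h]
  simpa using hc

theorem rep_chartPoint_div (hd : ∀ i, 0 < d i) (k : (i : Fin r) → Fin (n i + 1))
    (y : AffineIndex n → ℂ) (u : AffineIndex n) :
    (chartPoint d k y).rep (coordIndex hd k u) / (chartPoint d k y).rep (baseIndex d k) = y u := by
  obtain ⟨c, hc, h⟩ := exists_rep_chartPoint (d := d) k y
  rw [h, h]
  simp [hc]

theorem chartPoint_injective (hd : ∀ i, 0 < d i) (k : (i : Fin r) → Fin (n i + 1)) :
    Function.Injective (chartPoint d k) := by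
  intro y y' h
  funext u
  rw [← rep_chartPoint_div hd k y, h, rep_chartPoint_div]

/-- Dividing the coordinates of each factor by the one with index `l i` rescales all monomials by a
common constant. -/
theorem chartPoint_change (k l : (i : Fin r) → Fin (n i + 1)) (y : AffineIndex n → ℂ)
    (h : ∀ i, affinePoint k y i (l i) ≠ 0) : ∃ z, chartPoint d k y = chartPoint d l z := by
  refine ⟨fun u => affinePoint k y u.1 ((l u.1).succAbove u.2) / affinePoint k y u.1 (l u.1), ?_⟩
  rw [chartPoint, chartPoint, Projectivization.mk_eq_mk_iff']
  refine ⟨∏ i, (affinePoint k y i (l i)) ^ d i, funext fun J => ?_⟩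
  refine (monomialEval_mul (fun i => affinePoint k y i (l i)) _ J).symm.trans ?_
  rw [monomialVector_eq]
  congr 1
  funext i a
  have := h i
  cases a using (l i).succAboveCases with
  | x => simp
  | p b =>
    rw [affinePoint_succAbove]
    field_simp

end ChartPoints

/-! ### Tangent spaces, and tangency as singularity of forms. -/

section TangentSpace

open MvPolynomial

variable {r : ℕ} {n d : Fin r → ℕ}

/-- The parametrization of the tangent space at a point of a chart. -/
def tangentMap (d : Fin r → ℕ) (k : (i : Fin r) → Fin (n i + 1)) (y : AffineIndex n → ℂ) :
    ℂ × (AffineIndex n → ℂ) →ₗ[ℂ] (MultiIndex n d → ℂ) where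
  toFun p J := p.1 * eval y (monomialPoly k J) + ∑ u, eval y (pderiv u (monomialPoly k J)) * p.2 u
  map_add' p q := by
    funext J
    simp only [Prod.fst_add, Prod.snd_add, Pi.add_apply, add_mul, mul_add, Finset.sum_add_distrib]
    ring
  map_smul' c p := by
    funext J
    simp only [Prod.smul_fst, Prod.smul_snd, Pi.smul_apply, smul_eq_mul, RingHom.id_apply, mul_add,
      Finset.mul_sum]
    congr 1
    · ring
    · exact Finset.sum_congr rfl fun u _ => by ring

theorem tangentMap_apply (k : (i : Fin r) → Fin (n i + 1)) (y : AffineIndex n → ℂ)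
    (p : ℂ × (AffineIndex n → ℂ)) (J : MultiIndex n d) :
    tangentMap d k y p J =
      p.1 * eval y (monomialPoly k J) + ∑ u, eval y (pderiv u (monomialPoly k J)) * p.2 u := rfl

theorem tangentMap_injective (hd : ∀ i, 0 < d i) (k : (i : Fin r) → Fin (n i + 1))
    (y : AffineIndex n → ℂ) : Function.Injective (tangentMap d k y) := by
  classical
  rw [← LinearMap.ker_eq_bot, LinearMap.ker_eq_bot']
  intro p hp
  have h1 : p.1 = 0 := by
    have := congrFun hp (baseIndex d k)
    simpa [tangentMap_apply] using this
  have h2 : p.2 = 0 := by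
    funext u
    have := congrFun hp (coordIndex hd k u)
    rw [tangentMap_apply, h1, zero_mul, zero_add, monomialPoly_coordIndex,
      Finset.sum_eq_single u] at this
    · simpa using this
    · intro v _ hv
      rw [pderiv_X_of_ne (Ne.symm hv), map_zero, zero_mul]
    · simp
  exact Prod.ext h1 h2

theorem vanishesOn_aeval_eq_zero {F : MvPolynomial (MultiIndex n d) ℂ}
    (hF : VanishesOn (segreVeronese n d) F) (k : (i : Fin r) → Fin (n i + 1)) :
    aeval (monomialPoly k) F = 0 := by
  obtain ⟨⟨e, he⟩, hF⟩ := hF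
  apply MvPolynomial.funext
  intro y
  have h1 := hF _ (chartPoint_mem k y)
  rw [chartPoint, eval_rep_mk_eq_zero_iff he] at h1
  rw [eval_aeval, map_zero, ← h1]
  simp only [eval_monomialPoly]
  rfl

/-- Over the dual numbers, rep + εv is a scalar multiple of a point of the parametrization, so every
homogeneous equation of the variety vanishes on it. The ε-part of this is tangency. -/
theorem tangentMap_mem (k : (i : Fin r) → Fin (n i + 1)) (y : AffineIndex n → ℂ)
    (p : ℂ × (AffineIndex n → ℂ)) :
    tangentMap d k y p ∈ tangentSpace (segreVeronese n d) (chartPoint d k y) := by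
  intro F hF
  obtain ⟨c, hc, hrep⟩ := exists_rep_chartPoint (d := d) k y
  obtain ⟨e, he⟩ := hF.1
  set v := tangentMap d k y p with hv
  -- Dividing by c compensates for the scalar c between the representative and the monomial vector.
  let Y : AffineIndex n → DualNumber ℂ := fun u =>
    TrivSqZeroExt.inl (y u) + TrivSqZeroExt.inr (p.2 u / c)
  have hz : (fun J => (TrivSqZeroExt.inl ((chartPoint d k y).rep J) + TrivSqZeroExt.inr (v J) :
      DualNumber ℂ)) = fun J => (TrivSqZeroExt.inl c + TrivSqZeroExt.inr p.1) *
        aeval Y (monomialPoly k J) := by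
    funext J
    rw [aeval_dualNumber, hrep, hv, tangentMap_apply]
    ext
    · simp
    · have : c * ∑ u, eval y (pderiv u (monomialPoly k J)) * (p.2 u / c) =
          ∑ u, eval y (pderiv u (monomialPoly k J)) * p.2 u := by
        rw [Finset.mul_sum]
        refine Finset.sum_congr rfl fun u _ => ?_
        field_simp
      simp only [TrivSqZeroExt.snd_add, TrivSqZeroExt.snd_inl, TrivSqZeroExt.snd_inr, zero_add,
        TrivSqZeroExt.snd_mul, TrivSqZeroExt.fst_add, TrivSqZeroExt.fst_inl,
        TrivSqZeroExt.fst_inr, add_zero, smul_eq_mul, MulOpposite.smul_eq_mul_unop,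
        MulOpposite.unop_op]
      rw [this]
      ring
  have h1 := aeval_dualNumber (chartPoint d k y).rep v F
  have h3 : aeval (fun J => aeval Y (monomialPoly k J)) F = aeval Y (aeval (monomialPoly k) F) :=
    (comp_aeval_apply _ (aeval Y) F).symm
  rw [hz, aeval_mul_of_isHomogeneous he, h3, vanishesOn_aeval_eq_zero hF, map_zero, mul_zero] at h1
  have h2 := congrArg TrivSqZeroExt.snd h1
  simpa using h2.symm

/-- The index of the monomial which is the coordinate `a` of the factor `i` on a chart. -/
def homCoordIndex (hd : ∀ i, 0 < d i) (k : (i : Fin r) → Fin (n i + 1)) (i : Fin r) :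
    Fin (n i + 1) → MultiIndex n d :=
  Fin.insertNth (α := fun _ => MultiIndex n d) (k i) (baseIndex d k)
    fun b => coordIndex hd k ⟨i, b⟩

/-- An equation of the Segre-Veronese variety that expresses the coordinate `J` by affine
coordinates. -/
def chartEquation (hd : ∀ i, 0 < d i) (k : (i : Fin r) → Fin (n i + 1)) (J : MultiIndex n d) :
    MvPolynomial (MultiIndex n d) ℂ :=
  X (baseIndex d k) ^ (∑ i, d i + 1) * X J -
    X (baseIndex d k) ^ 2 * monomialEval (fun i a => X (homCoordIndex hd k i a)) J

theorem aeval_chartEquation {A : Type*} [CommRing A] [Algebra ℂ A] (hd : ∀ i, 0 < d i)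
    (k : (i : Fin r) → Fin (n i + 1)) (J : MultiIndex n d) (z : MultiIndex n d → A)
    (Y : AffineIndex n → A) (hY : ∀ u, z (coordIndex hd k u) = z (baseIndex d k) * Y u) :
    aeval z (chartEquation hd k J) = z (baseIndex d k) ^ (∑ i, d i + 1) *
      (z J - z (baseIndex d k) * monomialEval (affinePoint k Y) J) := by
  have h1 := map_monomialEval ((aeval z : MvPolynomial (MultiIndex n d) ℂ →ₐ[ℂ] A) :
    MvPolynomial (MultiIndex n d) ℂ →+* A) (fun i a => X (homCoordIndex hd k i a)) J
  have h2 : (fun (i : Fin r) (a : Fin (n i + 1)) =>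
      ((aeval z : MvPolynomial (MultiIndex n d) ℂ →ₐ[ℂ] A) :
      MvPolynomial (MultiIndex n d) ℂ →+* A) (X (homCoordIndex hd k i a))) =
      fun i a => z (baseIndex d k) * affinePoint k Y i a := by
    funext i a
    cases a using (k i).succAboveCases with
    | x => simp [homCoordIndex]
    | p b => simp [homCoordIndex, hY]
  rw [h2, monomialEval_mul, Finset.prod_pow_eq_pow_sum] at h1
  rw [chartEquation, map_sub, map_mul, map_mul, map_pow, map_pow, aeval_X, aeval_X]
  erw [h1]
  ring

/-- Off the chart both terms contain a positive power of the vanishing base coordinate; the surplus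
powers in the equation serve this purpose. -/
theorem vanishesOn_chartEquation (hd : ∀ i, 0 < d i) (k : (i : Fin r) → Fin (n i + 1))
    (J : MultiIndex n d) : VanishesOn (segreVeronese n d) (chartEquation hd k J) := by
  refine ⟨⟨∑ i, d i + 1 + 1, ?_⟩, fun p hp => ?_⟩
  · refine ((isHomogeneous_X_pow _ _).mul (isHomogeneous_X _ _)).sub ?_
    have h1 : (monomialEval (fun i a => (X (homCoordIndex hd k i a) :
        MvPolynomial (MultiIndex n d) ℂ)) J).IsHomogeneous (∑ i, d i) := by
      refine IsHomogeneous.prod _ _ _ fun i _ => ?_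
      have h2 : ∀ s : Multiset (Fin (n i + 1)), ((s.map fun a =>
          (X (homCoordIndex hd k i a) : MvPolynomial (MultiIndex n d) ℂ)).prod).IsHomogeneous
          s.card := by
        intro s
        induction s using Multiset.induction_on with
        | empty => simpa using isHomogeneous_one _ _
        | cons a s ih =>
          rw [Multiset.map_cons, Multiset.prod_cons, Multiset.card_cons, mul_comm]
          exact ih.mul (isHomogeneous_X _ _)
      have h3 := h2 (J i)
      rwa [Sym.card_coe] at h3
    have h4 := (isHomogeneous_X_pow (R := ℂ) (baseIndex d k) 2).mul h1
    rwa [show ∑ i, d i + 1 + 1 = 2 + ∑ i, d i by ring]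
  · by_cases h0 : p.rep (baseIndex d k) = 0
    · simp [chartEquation, h0]
    · obtain ⟨y, rfl⟩ := exists_eq_chartPoint_of_rep_ne_zero hd k hp h0
      obtain ⟨c, hc, hrep⟩ := exists_rep_chartPoint (d := d) k y
      have h1 := aeval_chartEquation hd k J (chartPoint d k y).rep y (by
        intro u
        simp [hrep])
      rw [aeval_eq_eval] at h1
      erw [h1]
      rw [hrep J, hrep (baseIndex d k), eval_monomialPoly, eval_monomialPoly]
      simp

/-- For the inclusion from left to right, the chart equations hold at rep + εv, whose base
coordinate is a unit. Every coordinate of v is then determined by its base coordinate and its affine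
coordinates, and these provide the preimage. -/
theorem tangentSpace_chartPoint (hd : ∀ i, 0 < d i) (k : (i : Fin r) → Fin (n i + 1))
    (y : AffineIndex n → ℂ) :
    tangentSpace (segreVeronese n d) (chartPoint d k y) = LinearMap.range (tangentMap d k y) := by
  apply le_antisymm
  · intro v hv
    obtain ⟨c, hc, hrep⟩ := exists_rep_chartPoint (d := d) k y
    let z : MultiIndex n d → DualNumber ℂ := fun J =>
      TrivSqZeroExt.inl ((chartPoint d k y).rep J) + TrivSqZeroExt.inr (v J)
    let w : AffineIndex n → ℂ := fun u => (v (coordIndex hd k u) - v (baseIndex d k) * y u) / c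
    let Y : AffineIndex n → DualNumber ℂ := fun u =>
      TrivSqZeroExt.inl (y u) + TrivSqZeroExt.inr (w u)
    have hY : ∀ u, z (coordIndex hd k u) = z (baseIndex d k) * Y u := by
      intro u
      ext
      · simp [z, Y, hrep]
      · simp [z, Y, w, hrep]
        field_simp
        ring
    have hunit : IsUnit (z (baseIndex d k)) := by
      rw [TrivSqZeroExt.isUnit_iff_isUnit_fst]
      simp [z, hrep, hc]
    refine ⟨(v (baseIndex d k), c • w), funext fun J => ?_⟩
    have h1 := aeval_dualNumber (chartPoint d k y).rep v (chartEquation hd k J)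
    have h2 := vanishesOn_chartEquation hd k J
    rw [hv _ h2, h2.2 _ (chartPoint_mem k y), TrivSqZeroExt.inl_zero, TrivSqZeroExt.inr_zero,
      add_zero] at h1
    have h3 := aeval_chartEquation hd k J z Y hY
    have h4 : z J = z (baseIndex d k) * aeval Y (monomialPoly k J) := by
      rw [aeval_monomialPoly]
      have h5 := h3.symm.trans h1
      rw [(hunit.pow _).mul_right_eq_zero, sub_eq_zero] at h5
      exact h5
    rw [aeval_dualNumber] at h4
    have h6 := congrArg TrivSqZeroExt.snd h4
    simp [z, hrep] at h6
    rw [h6, tangentMap_apply]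
    simp only [Pi.smul_apply, smul_eq_mul, Finset.mul_sum]
    rw [add_comm]
    congr 1
    exact Finset.sum_congr rfl fun u _ => by ring
  · rintro _ ⟨p, rfl⟩
    exact tangentMap_mem k y p

/-- The parametrization `tangentMap` is injective, so all tangent spaces have the same dimension. -/
theorem isSmoothPoint_of_mem (hd : ∀ i, 0 < d i) {x : PSpace (MultiIndex n d)}
    (hx : x ∈ segreVeronese n d) : IsSmoothPoint (segreVeronese n d) x := by
  have h : ∀ x ∈ segreVeronese n d, Module.finrank ℂ (tangentSpace (segreVeronese n d) x) =
      Module.finrank ℂ (ℂ × (AffineIndex n → ℂ)) := by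
    intro x hx
    obtain ⟨k, y, rfl⟩ := exists_eq_chartPoint hx
    rw [tangentSpace_chartPoint hd, LinearMap.finrank_range_of_inj (tangentMap_injective hd k y)]
  exact ⟨hx, fun y hy => by rw [h x hx, h y hy]⟩

/-- The form of multidegree `d` with coefficients `H`, in the affine coordinates of a chart. -/
def formPoly (k : (i : Fin r) → Fin (n i + 1)) (H : MultiIndex n d → ℂ) :
    MvPolynomial (AffineIndex n) ℂ :=
  ∑ J, C (H J) * monomialPoly k J

/-- The form with coefficients `H` is singular at the point with affine coordinates `y`. -/
def IsSingularAt (k : (i : Fin r) → Fin (n i + 1)) (H : MultiIndex n d → ℂ)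
    (y : AffineIndex n → ℂ) : Prop :=
  eval y (formPoly k H) = 0 ∧ ∀ u, eval y (pderiv u (formPoly k H)) = 0

theorem eval_formPoly (k : (i : Fin r) → Fin (n i + 1)) (H : MultiIndex n d → ℂ)
    (y : AffineIndex n → ℂ) :
    eval y (formPoly k H) = ∑ J, H J * eval y (monomialPoly k J) := by
  simp [formPoly]

theorem eval_pderiv_formPoly (k : (i : Fin r) → Fin (n i + 1)) (H : MultiIndex n d → ℂ)
    (y : AffineIndex n → ℂ) (u : AffineIndex n) :
    eval y (pderiv u (formPoly k H)) = ∑ J, H J * eval y (pderiv u (monomialPoly k J)) := by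
  simp [formPoly]

theorem sum_mul_tangentMap (k : (i : Fin r) → Fin (n i + 1)) (H : MultiIndex n d → ℂ)
    (y : AffineIndex n → ℂ) (p : ℂ × (AffineIndex n → ℂ)) :
    ∑ J, H J * tangentMap d k y p J = p.1 * eval y (formPoly k H) +
      ∑ u, eval y (pderiv u (formPoly k H)) * p.2 u := by
  simp only [tangentMap_apply, eval_formPoly, eval_pderiv_formPoly, mul_add,
    Finset.sum_add_distrib, Finset.mul_sum, Finset.sum_mul]
  congr 1
  · exact Finset.sum_congr rfl fun J _ => by ring
  · rw [Finset.sum_comm]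
    exact Finset.sum_congr rfl fun u _ => Finset.sum_congr rfl fun J _ => by ring

/-- Tangency of hyperplanes and singularity of forms. -/
theorem forall_mem_tangentSpace_iff (hd : ∀ i, 0 < d i) (k : (i : Fin r) → Fin (n i + 1))
    (H : MultiIndex n d → ℂ) (y : AffineIndex n → ℂ) :
    (∀ v ∈ tangentSpace (segreVeronese n d) (chartPoint d k y), ∑ J, H J * v J = 0) ↔
      IsSingularAt k H y := by
  classical
  rw [tangentSpace_chartPoint hd]
  constructor
  · intro h
    constructor
    · have := h _ ⟨(1, 0), rfl⟩
      rw [sum_mul_tangentMap] at this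
      simpa using this
    · intro u
      have := h _ ⟨(0, Pi.single u 1), rfl⟩
      rw [sum_mul_tangentMap] at this
      simpa [Pi.single_apply] using this
  · rintro ⟨h1, h2⟩ _ ⟨p, rfl⟩
    rw [sum_mul_tangentMap, h1]
    simp [h2]

theorem isTangentAt_chartPoint_iff (hd : ∀ i, 0 < d i) (k : (i : Fin r) → Fin (n i + 1))
    (H : PSpace (MultiIndex n d)) (y : AffineIndex n → ℂ) :
    IsTangentAt (segreVeronese n d) H (chartPoint d k y) ↔ IsSingularAt k H.rep y :=
  forall_mem_tangentSpace_iff hd k H.rep y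

theorem IsSingularAt.smul {k : (i : Fin r) → Fin (n i + 1)} {H : MultiIndex n d → ℂ}
    {y : AffineIndex n → ℂ} (h : IsSingularAt k H y) (c : ℂ) : IsSingularAt k (c • H) y := by
  constructor
  · have := h.1
    rw [eval_formPoly] at this ⊢
    simp only [Pi.smul_apply, smul_eq_mul, mul_assoc, ← Finset.mul_sum, this, mul_zero]
  · intro u
    have := h.2 u
    rw [eval_pderiv_formPoly] at this ⊢
    simp only [Pi.smul_apply, smul_eq_mul, mul_assoc, ← Finset.mul_sum, this, mul_zero]

/-- Restates the closure in terms of coefficient vectors, free of chosen representatives. All points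
are smooth, so smoothness disappears from the condition. -/
theorem mem_dualVariety_iff (hd : ∀ i, 0 < d i) {p : PSpace (MultiIndex n d)} :
    p ∈ dualVariety (segreVeronese n d) ↔
      ∀ (F : MvPolynomial (MultiIndex n d) ℂ) (e : ℕ), F.IsHomogeneous e →
        (∀ k y H, H ≠ 0 → IsSingularAt k H y → eval H F = 0) → eval p.rep F = 0 := by
  rw [dualVariety, mem_closure_iff_forall_eval]
  refine forall_congr' fun F => forall_congr' fun e => forall_congr' fun he => ?_
  refine imp_congr_left ⟨fun h k y H hH hs => ?_, ?_⟩
  · rw [← eval_rep_mk_eq_zero_iff he H hH]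
    refine h _ ⟨chartPoint d k y, isSmoothPoint_of_mem hd (chartPoint_mem k y), ?_⟩
    rw [isTangentAt_chartPoint_iff hd]
    obtain ⟨c, -, hc⟩ := exists_rep_mk H hH
    rw [hc]
    exact hs.smul c
  · rintro h H ⟨x, hx, ht⟩
    obtain ⟨k, y, rfl⟩ := exists_eq_chartPoint hx.1
    rw [isTangentAt_chartPoint_iff hd] at ht
    exact h k y _ H.rep_nonzero ht

end TangentSpace

/-! ### Projection onto the forms singular at a point. -/

section SingularForms

open MvPolynomial

variable {r : ℕ} {n d : Fin r → ℕ}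

/-- Subtract from a form its first order expansion at a point. -/
def singularPart (hd : ∀ i, 0 < d i) (k : (i : Fin r) → Fin (n i + 1)) (y : AffineIndex n → ℂ)
    (H : MultiIndex n d → ℂ) : MultiIndex n d → ℂ := fun J =>
  H J - ∑ u, (if J = coordIndex hd k u then eval y (pderiv u (formPoly k H)) else 0) -
    (if J = baseIndex d k then
      eval y (formPoly k H) - ∑ u, y u * eval y (pderiv u (formPoly k H)) else 0)

/-- The indices `coordIndex` and `baseIndex` carry the monomials x_u and 1, so an affine-linear
polynomial can be subtracted without leaving multidegree d. -/
theorem formPoly_singularPart (hd : ∀ i, 0 < d i) (k : (i : Fin r) → Fin (n i + 1))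
    (y : AffineIndex n → ℂ) (H : MultiIndex n d → ℂ) :
    formPoly k (singularPart hd k y H) = formPoly k H -
      ∑ u, C (eval y (pderiv u (formPoly k H))) * X u -
      C (eval y (formPoly k H) - ∑ u, y u * eval y (pderiv u (formPoly k H))) := by
  rw [formPoly]
  simp only [singularPart, C_sub, sub_mul, Finset.sum_sub_distrib]
  rw [← formPoly]
  congr 1
  · congr 1
    simp only [map_sum, Finset.sum_mul]
    rw [Finset.sum_comm]
    refine Finset.sum_congr rfl fun u _ => ?_
    rw [Finset.sum_eq_single (coordIndex hd k u)]
    · simp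
    · intro J _ hJ
      simp [hJ]
    · simp
  · rw [Finset.sum_eq_single (baseIndex d k)]
    · simp
    · intro J _ hJ
      simp [hJ]
    · simp

theorem pderiv_formPoly_singularPart (hd : ∀ i, 0 < d i) (k : (i : Fin r) → Fin (n i + 1))
    (y : AffineIndex n → ℂ) (H : MultiIndex n d → ℂ) (u : AffineIndex n) :
    pderiv u (formPoly k (singularPart hd k y H)) =
      pderiv u (formPoly k H) - C (eval y (pderiv u (formPoly k H))) := by
  classical
  rw [formPoly_singularPart, map_sub, map_sub, pderiv_C, sub_zero, map_sum,
    Finset.sum_eq_single u]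
  · rw [pderiv_C_mul, pderiv_X_self, mul_one]
  · intro v _ hv
    rw [pderiv_C_mul, pderiv_X_of_ne hv, mul_zero]
  · simp

theorem isSingularAt_singularPart (hd : ∀ i, 0 < d i) (k : (i : Fin r) → Fin (n i + 1))
    (y : AffineIndex n → ℂ) (H : MultiIndex n d → ℂ) :
    IsSingularAt k (singularPart hd k y H) y := by
  constructor
  · rw [formPoly_singularPart]
    simp [mul_comm]
  · intro u
    rw [pderiv_formPoly_singularPart]
    simp

theorem singularPart_of_isSingularAt (hd : ∀ i, 0 < d i) {k : (i : Fin r) → Fin (n i + 1)}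
    {y : AffineIndex n → ℂ} {H : MultiIndex n d → ℂ} (h : IsSingularAt k H y) :
    singularPart hd k y H = H := by
  funext J
  simp [singularPart, h.1, h.2]

theorem continuous_singularPart (hd : ∀ i, 0 < d i) (k : (i : Fin r) → Fin (n i + 1))
    (H : MultiIndex n d → ℂ) : Continuous fun y => singularPart hd k y H := by
  refine continuous_pi fun J => ?_
  unfold singularPart
  refine (continuous_const.sub (continuous_finsetSum _ fun u _ => ?_)).sub ?_
  · split_ifs
    · exact continuous_eval _
    · exact continuous_const
  · split_ifs
    · exact (continuous_eval _).sub (continuous_finsetSum _ fun u _ =>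
        (continuous_apply u).mul (continuous_eval _))
    · exact continuous_const

theorem IsSingularAt.of_chartPoint_eq (hd : ∀ i, 0 < d i) {k l : (i : Fin r) → Fin (n i + 1)}
    {y z : AffineIndex n → ℂ} {H : MultiIndex n d → ℂ} (h : IsSingularAt k H y)
    (hz : chartPoint d k y = chartPoint d l z) : IsSingularAt l H z := by
  rw [← forall_mem_tangentSpace_iff hd] at h ⊢
  rwa [← hz]

/-- A polynomial that vanishes on the forms with a singular point in one chart vanishes on all
singular forms. -/
theorem eval_eq_zero_of_isSingularAt (hd : ∀ i, 0 < d i) (l : (i : Fin r) → Fin (n i + 1))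
    {G : MvPolynomial (MultiIndex n d) ℂ} (hG : ∀ y H, IsSingularAt l H y → eval H G = 0)
    {k : (i : Fin r) → Fin (n i + 1)} {y : AffineIndex n → ℂ} {H : MultiIndex n d → ℂ}
    (h : IsSingularAt k H y) : eval H G = 0 := by
  -- Translate the point by t in all affine coordinates and correct H to stay singular there. For
  -- all but finitely many t no affine coordinate vanishes and the point lies in chart l; continuity
  -- then gives t = 0.
  let f : ℂ → ℂ := fun t => eval (singularPart hd k (fun u => y u + t) H) G
  have hf : Continuous f := by
    refine (continuous_eval G).comp ((continuous_singularPart hd k H).comp ?_)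
    fun_prop
  have hf0 : f 0 = eval H G := by
    simp only [f, add_zero]
    rw [singularPart_of_isSingularAt hd h]
  rw [← hf0]
  let E : Set ℂ := Set.range fun u => - y u
  have hE : E.Finite := Set.finite_range _
  have hd' : Dense Eᶜ := hE.countable.dense_compl ℂ
  have hz : Set.EqOn f (fun _ => 0) Eᶜ := by
    intro t ht
    obtain ⟨z, hz⟩ := chartPoint_change (d := d) k l (fun u => y u + t) (by
      intro i
      generalize l i = a
      cases a using (k i).succAboveCases with
      | x => simp
      | p b =>
        rw [affinePoint_succAbove]
        intro h0
        exact ht ⟨⟨i, b⟩, (eq_neg_of_add_eq_zero_right h0).symm⟩)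
    exact hG z _ ((isSingularAt_singularPart hd k _ H).of_chartPoint_eq hd hz)
  exact congrFun (Continuous.ext_on hd' hf continuous_const hz) 0

end SingularForms

/-! ### Parameter counts. -/

section Counting

open MvPolynomial

/-- Vectors which satisfy linear equations in echelon form, with coefficients that depend
polynomially on few parameters, satisfy an algebraic equation. -/
theorem exists_eval_eq_zero_of_card_lt {σ σ' U V : Type} [Fintype σ] [Fintype σ'] [Fintype U]
    [Fintype V] [DecidableEq V] (κ : V → σ) (j : σ' → σ) (e : V → σ → MvPolynomial U ℂ)
    (he : ∀ v v', e v (κ v') = if v = v' then 1 else 0)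
    (hcard : Fintype.card U + Fintype.card σ < Fintype.card V + Fintype.card σ') :
    ∃ R : MvPolynomial σ' ℂ, R ≠ 0 ∧ ∀ (y : U → ℂ) (h : σ → ℂ),
      (∀ v, ∑ J, eval y (e v J) * h J = 0) → eval (fun s => h (j s)) R = 0 := by
  classical
  have hκ : Function.Injective κ := by
    intro v v' hv
    have h1 := he v v'
    rw [← hv, he v v, if_pos rfl] at h1
    by_contra hne
    rw [if_neg hne] at h1
    exact one_ne_zero h1
  let p : σ → Prop := fun J => ∃ v, κ v = J
  obtain ⟨ε, hε⟩ : ∃ ε : V ≃ {J // p J}, ∀ v, (ε v : σ) = κ v :=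
    ⟨Equiv.ofBijective (fun v => ⟨κ v, v, rfl⟩) ⟨fun v v' h => hκ (congrArg Subtype.val h),
      fun J => J.2.imp fun v hv => Subtype.ext hv⟩, fun _ => rfl⟩
  -- The echelon form solves for the coordinates in the image of κ. All coordinates become
  -- polynomials in the parameters and the remaining coordinates, of which there are fewer than
  -- elements of σ'.
  let Φ : σ → MvPolynomial (U ⊕ {J // ¬ p J}) ℂ := fun J =>
    if hJ : p J then
      - ∑ J' : {J // ¬ p J}, rename Sum.inl (e hJ.choose J') * X (Sum.inr J')
    else X (Sum.inr ⟨J, hJ⟩)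
  have hcard' : Fintype.card {J // ¬ p J} + Fintype.card V = Fintype.card σ := by
    rw [Fintype.card_congr ε, add_comm]
    rw [Fintype.card_subtype_compl]
    exact Nat.add_sub_of_le (Fintype.card_subtype_le _)
  obtain ⟨R, hR0, hR⟩ := exists_algebraic_relation (τ := U ⊕ {J // ¬ p J}) (σ := σ')
    (by rw [Fintype.card_sum]; omega) (fun s => Φ (j s))
  refine ⟨R, hR0, fun y h hh => ?_⟩
  have hΦ : ∀ J, eval (Sum.elim y fun J : {J // ¬ p J} => h J) (Φ J) = h J := by
    intro J
    by_cases hJ : p J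
    · have hc := hJ.choose_spec
      have h1 := hh hJ.choose
      rw [← Fintype.sum_subtype_add_sum_subtype p, ← ε.sum_comp] at h1
      simp only [hε, he] at h1
      simp only [Φ, dif_pos hJ, map_neg, map_sum, map_mul, eval_rename, eval_X, Sum.elim_inr,
        Function.comp_def, Sum.elim_inl]
      have h2 : ∑ x, eval y (if hJ.choose = x then 1 else 0) * h (κ x) = h J := by
        rw [Finset.sum_eq_single hJ.choose]
        · simp [hc]
        · intro b _ hb
          simp [Ne.symm hb]
        · simp
      rw [h2] at h1
      linear_combination -h1
    · simp [Φ, hJ]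
  have h2 := eval_aeval (fun s => Φ (j s)) (Sum.elim y fun J : {J // ¬ p J} => h J) R
  rw [hR, map_zero] at h2
  simp only [hΦ] at h2
  exact h2.symm

end Counting

/-! ### The case of a large last factor of degree one. -/

section LinearLastFactor

open MvPolynomial

variable {m : ℕ} {n d : Fin (m + 1) → ℕ}

/-- Affine coordinates of the factors other than the last one. -/
def initIndex (u : AffineIndex fun i : Fin m => n i.castSucc) : AffineIndex n :=
  ⟨u.1.castSucc, u.2⟩

theorem initIndex_injective : Function.Injective (initIndex (n := n)) := by
  rintro ⟨i, a⟩ ⟨j, b⟩ h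
  simp only [initIndex, Sigma.mk.injEq] at h
  obtain rfl : i = j := Fin.castSucc_injective m h.1
  simpa using h.2

theorem affineIndex_cases (u : AffineIndex n) :
    (∃ v, u = initIndex v) ∨ ∃ b, u = ⟨Fin.last m, b⟩ := by
  obtain ⟨i, a⟩ := u
  induction i using Fin.lastCases with
  | last => exact Or.inr ⟨a, rfl⟩
  | cast i => exact Or.inl ⟨⟨i, a⟩, rfl⟩

theorem initIndex_ne_last (u : AffineIndex fun i : Fin m => n i.castSucc)
    (b : Fin (n (Fin.last m))) : initIndex u ≠ ⟨Fin.last m, b⟩ := by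
  intro h
  exact (Fin.castSucc_lt_last u.1).ne (congrArg Sigma.fst h)

theorem exists_eq_singleton (h1 : d (Fin.last m) = 1) (J : MultiIndex n d) :
    ∃ a, (J (Fin.last m) : Multiset (Fin (n (Fin.last m) + 1))) = {a} := by
  rw [← Multiset.card_eq_one, Sym.card_coe, h1]

/-- The coordinate of the last factor in a monomial that is linear there. -/
def lastElem (h1 : d (Fin.last m) = 1) (J : MultiIndex n d) : Fin (n (Fin.last m) + 1) :=
  (exists_eq_singleton h1 J).choose

theorem coe_last_eq (h1 : d (Fin.last m) = 1) (J : MultiIndex n d) :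
    (J (Fin.last m) : Multiset (Fin (n (Fin.last m) + 1))) = {lastElem h1 J} :=
  (exists_eq_singleton h1 J).choose_spec

/-- The part of a monomial that involves the factors other than the last one. -/
def initPoly (k : (i : Fin (m + 1)) → Fin (n i + 1)) (J : MultiIndex n d) :
    MvPolynomial (AffineIndex fun i : Fin m => n i.castSucc) ℂ :=
  monomialPoly (n := fun i : Fin m => n i.castSucc) (d := fun i : Fin m => d i.castSucc)
    (fun i => k i.castSucc) fun i => J i.castSucc

theorem monomialPoly_eq_mul (h1 : d (Fin.last m) = 1) (k : (i : Fin (m + 1)) → Fin (n i + 1))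
    (J : MultiIndex n d) :
    monomialPoly k J = affinePoint k X (Fin.last m) (lastElem h1 J) *
      rename initIndex (initPoly k J) := by
  have h2 : rename initIndex (initPoly k J) =
      aeval (fun u => X (initIndex u)) (initPoly k J) := by
    rw [rename_eq_aeval]; rfl
  rw [h2, initPoly, aeval_monomialPoly, monomialPoly, monomialEval, Fin.prod_univ_castSucc,
    coe_last_eq h1, Multiset.map_singleton, Multiset.prod_singleton, mul_comm]
  rfl

/-- The coefficients of a form that is linear in the last factor. -/
def lastCoeff (h1 : d (Fin.last m) = 1) (k : (i : Fin (m + 1)) → Fin (n i + 1))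
    (H : MultiIndex n d → ℂ) (a : Fin (n (Fin.last m) + 1)) :
    MvPolynomial (AffineIndex fun i : Fin m => n i.castSucc) ℂ :=
  ∑ J, if a = lastElem h1 J then C (H J) * initPoly k J else 0

theorem formPoly_eq_sum_lastCoeff (h1 : d (Fin.last m) = 1)
    (k : (i : Fin (m + 1)) → Fin (n i + 1)) (H : MultiIndex n d → ℂ) :
    formPoly k H = ∑ a, affinePoint k X (Fin.last m) a *
      rename initIndex (lastCoeff h1 k H a) := by
  simp only [formPoly, lastCoeff, map_sum, Finset.mul_sum]
  rw [Finset.sum_comm]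
  refine Finset.sum_congr rfl fun J _ => ?_
  rw [Finset.sum_eq_single (lastElem h1 J)]
  · rw [if_pos rfl, monomialPoly_eq_mul h1, map_mul, rename_C]
    ring
  · intro a _ ha
    rw [if_neg ha, map_zero, mul_zero]
  · simp

theorem pderiv_last_rename (b : Fin (n (Fin.last m)))
    (g : MvPolynomial (AffineIndex fun i : Fin m => n i.castSucc) ℂ) :
    pderiv (⟨Fin.last m, b⟩ : AffineIndex n) (rename initIndex g) = 0 := by
  classical
  apply pderiv_eq_zero_of_notMem_vars
  intro h
  obtain ⟨u, -, hu⟩ := Finset.mem_image.mp (vars_rename initIndex g h)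
  exact initIndex_ne_last u b hu

theorem pderiv_last_formPoly (h1 : d (Fin.last m) = 1)
    (k : (i : Fin (m + 1)) → Fin (n i + 1)) (H : MultiIndex n d → ℂ)
    (b : Fin (n (Fin.last m))) :
    pderiv ⟨Fin.last m, b⟩ (formPoly k H) =
      rename initIndex (lastCoeff h1 k H ((k (Fin.last m)).succAbove b)) := by
  rw [formPoly_eq_sum_lastCoeff h1, map_sum,
    Fin.sum_univ_succAbove _ (k (Fin.last m)), Finset.sum_eq_single b]
  · simp [Derivation.leibniz, pderiv_last_rename]
  · intro c _ hc
    have : (⟨Fin.last m, c⟩ : AffineIndex n) ≠ ⟨Fin.last m, b⟩ := by simpa using hc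
    simp [Derivation.leibniz, pderiv_last_rename, pderiv_X_of_ne this]
  · simp

theorem pderiv_init_formPoly (h1 : d (Fin.last m) = 1)
    (k : (i : Fin (m + 1)) → Fin (n i + 1)) (H : MultiIndex n d → ℂ)
    (u : AffineIndex fun i : Fin m => n i.castSucc) :
    pderiv (initIndex u) (formPoly k H) = ∑ a, affinePoint k X (Fin.last m) a *
      rename initIndex (pderiv u (lastCoeff h1 k H a)) := by
  rw [formPoly_eq_sum_lastCoeff h1, map_sum]
  refine Finset.sum_congr rfl fun a _ => ?_
  rw [Derivation.leibniz, pderiv_rename initIndex_injective]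
  cases a using (k (Fin.last m)).succAboveCases with
  | x => simp
  | p b =>
    rw [affinePoint_succAbove, pderiv_X_of_ne (initIndex_ne_last u b).symm]
    simp

theorem eval_affinePoint_X {r : ℕ} {n : Fin r → ℕ} (k : (i : Fin r) → Fin (n i + 1))
    (y : AffineIndex n → ℂ) (i : Fin r) (a : Fin (n i + 1)) :
    eval y (affinePoint k X i a) = affinePoint k y i a := by
  rw [map_affinePoint]
  simp

/-- A form that is linear in the last factor is singular at a point if and only if its
coefficients vanish there together with the derivatives with respect to the other factors. -/
theorem isSingularAt_iff_lastCoeff (h1 : d (Fin.last m) = 1)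
    (k : (i : Fin (m + 1)) → Fin (n i + 1)) (H : MultiIndex n d → ℂ) (y : AffineIndex n → ℂ) :
    IsSingularAt k H y ↔ (∀ a, eval (fun u => y (initIndex u)) (lastCoeff h1 k H a) = 0) ∧
      ∀ u, ∑ a, affinePoint k y (Fin.last m) a *
        eval (fun u => y (initIndex u)) (pderiv u (lastCoeff h1 k H a)) = 0 := by
  have hinit : ∀ u, eval y (pderiv (initIndex u) (formPoly k H)) =
      ∑ a, affinePoint k y (Fin.last m) a *
        eval (fun u => y (initIndex u)) (pderiv u (lastCoeff h1 k H a)) := by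
    intro u
    simp only [pderiv_init_formPoly h1, map_sum, map_mul, eval_affinePoint_X, eval_rename]
    rfl
  have hlast : ∀ b, eval y (pderiv ⟨Fin.last m, b⟩ (formPoly k H)) =
      eval (fun u => y (initIndex u)) (lastCoeff h1 k H ((k (Fin.last m)).succAbove b)) := by
    intro b
    rw [pderiv_last_formPoly h1, eval_rename]
    rfl
  have hform : eval y (formPoly k H) = ∑ a, affinePoint k y (Fin.last m) a *
      eval (fun u => y (initIndex u)) (lastCoeff h1 k H a) := by
    simp only [formPoly_eq_sum_lastCoeff h1, map_sum, map_mul, eval_affinePoint_X, eval_rename]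
    rfl
  constructor
  · intro h
    refine ⟨fun a => ?_, fun u => (hinit u).symm.trans (h.2 _)⟩
    have hb : ∀ b, eval (fun u => y (initIndex u))
        (lastCoeff h1 k H ((k (Fin.last m)).succAbove b)) = 0 :=
      fun b => (hlast b).symm.trans (h.2 _)
    cases a using (k (Fin.last m)).succAboveCases with
    | x =>
      have h3 := h.1
      rw [hform, Fin.sum_univ_succAbove _ (k (Fin.last m))] at h3
      simpa [hb] using h3
    | p b => exact hb b
  · rintro ⟨h2, h3⟩
    refine ⟨?_, fun u => ?_⟩
    · rw [hform]
      simp [h2]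
    · rcases affineIndex_cases u with ⟨v, rfl⟩ | ⟨b, rfl⟩
      · rw [hinit, h3]
      · rw [hlast, h2]

/-- If the last factor is large, singularities come in lines. -/
theorem exists_line_isSingularAt (h1 : d (Fin.last m) = 1)
    (hlt : ∑ i : Fin m, n i.castSucc < n (Fin.last m))
    {k : (i : Fin (m + 1)) → Fin (n i + 1)} {H : MultiIndex n d → ℂ} {y : AffineIndex n → ℂ}
    (h : IsSingularAt k H y) :
    ∃ w : AffineIndex n → ℂ, w ≠ 0 ∧ ∀ t : ℂ, IsSingularAt k H (fun u => y u + t * w u) := by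
  rw [isSingularAt_iff_lastCoeff h1] at h
  -- The conditions on a displacement in the last factor are linear: as many equations as affine
  -- coordinates in the other factors, fewer than the unknowns.
  let L : (Fin (n (Fin.last m)) → ℂ) →ₗ[ℂ]
      ((AffineIndex fun i : Fin m => n i.castSucc) → ℂ) :=
    Matrix.toLin' (Matrix.of fun u b => eval (fun u => y (initIndex u))
      (pderiv u (lastCoeff h1 k H ((k (Fin.last m)).succAbove b))))
  have hker : LinearMap.ker L ≠ ⊥ := by
    apply LinearMap.ker_ne_bot_of_finrank_lt
    simpa using hlt
  obtain ⟨w, hw, hw0⟩ := Submodule.exists_mem_ne_zero_of_ne_bot hker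
  have hw' : ∀ u, ∑ b, eval (fun u => y (initIndex u))
      (pderiv u (lastCoeff h1 k H ((k (Fin.last m)).succAbove b))) * w b = 0 :=
    fun u => congrFun (LinearMap.mem_ker.mp hw) u
  let W : AffineIndex n → ℂ := fun u =>
    Fin.lastCases (motive := fun i => Fin (n i) → ℂ) w (fun _ _ => 0) u.1 u.2
  have hWlast : ∀ b, W ⟨Fin.last m, b⟩ = w b := fun b => by simp [W]
  have hWinit : ∀ u, W (initIndex u) = 0 := fun u => by simp [W, initIndex]
  refine ⟨W, ?_, fun t => ?_⟩
  · intro h0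
    apply hw0
    funext b
    rw [← hWlast, h0]
    rfl
  · rw [isSingularAt_iff_lastCoeff h1]
    simp only [hWinit, mul_zero, add_zero]
    refine ⟨h.1, fun u => ?_⟩
    have h2 := h.2 u
    have h3 := hw' u
    rw [Fin.sum_univ_succAbove _ (k (Fin.last m))] at h2 ⊢
    simp only [affinePoint_self, affinePoint_succAbove, hWlast, add_mul,
      Finset.sum_add_distrib, one_mul] at h2 ⊢
    rw [← add_assoc, h2, zero_add]
    calc _ = t * ∑ b, eval (fun u => y (initIndex u))
          (pderiv u (lastCoeff h1 k H ((k (Fin.last m)).succAbove b))) * w b := by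
          rw [Finset.mul_sum]
          exact Finset.sum_congr rfl fun b _ => by ring
      _ = 0 := by rw [h3, mul_zero]

/-- No genericity is needed: a line in the chart lies in the tangency locus through every point of
contact, so both dense open sets are everything. -/
theorem isOneWeaklyDefective_of_lt (hd : ∀ i, 0 < d i) (h1 : d (Fin.last m) = 1)
    (hlt : ∑ i : Fin m, n i.castSucc < n (Fin.last m)) :
    IsOneWeaklyDefective (segreVeronese n d) := by
  refine ⟨Set.univ, isOpen_univ, by rw [Set.univ_inter]; exact subset_closure, ?_⟩
  rintro x ⟨-, hx⟩
  refine ⟨Set.univ, isOpen_univ, by rw [Set.univ_inter]; exact subset_closure, ?_⟩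
  rintro H ⟨-, hH⟩
  obtain ⟨k, y, rfl⟩ := exists_eq_chartPoint hx
  have hs : IsSingularAt k H.rep y := (isTangentAt_chartPoint_iff hd k H y).mp hH
  obtain ⟨w, hw0, hw⟩ := exists_line_isSingularAt h1 hlt hs
  let f : ℂ → PSpace (MultiIndex n d) := fun t => chartPoint d k fun u => y u + t * w u
  have hf0 : f 0 = chartPoint d k y := by simp [f]
  refine topologicalKrullDim_contactLocus_pos (ℓ := Set.range f) ?_ ?_ ⟨0, hf0⟩ ?_
  · refine isIrreducible_range_curve (fun J => aeval (fun u => Polynomial.C (y u) +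
      Polynomial.X * Polynomial.C (w u)) (monomialPoly k J)) f fun t => ?_
    obtain ⟨c, hc, h⟩ := exists_rep_chartPoint (d := d) k fun u => y u + t * w u
    refine ⟨c, hc, funext fun J => ?_⟩
    rw [h, Pi.smul_apply, smul_eq_mul]
    congr 1
    have h2 := comp_aeval_apply (fun u => Polynomial.C (y u) + Polynomial.X * Polynomial.C (w u))
      (Polynomial.aeval t : Polynomial ℂ →ₐ[ℂ] ℂ) (monomialPoly k J)
    simp only [map_add, map_mul, Polynomial.aeval_C, Polynomial.aeval_X, Algebra.algebraMap_self,
      RingHom.id_apply, aeval_eq_eval, Polynomial.coe_aeval_eq_eval] at h2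
    exact h2.symm
  · rintro _ ⟨t, rfl⟩
    exact ⟨chartPoint_mem _ _, (isTangentAt_chartPoint_iff hd k H _).mpr (hw t)⟩
  · refine ⟨f 0, ⟨0, rfl⟩, f 1, ⟨1, rfl⟩, fun h => hw0 (funext fun u => ?_)⟩
    have := congrFun (chartPoint_injective hd k h) u
    simpa using this

/-- If the last factor is large, all singular forms satisfy a nontrivial algebraic equation that
does not involve a given coefficient. -/
theorem exists_equation_without_variable (h1 : d (Fin.last m) = 1)
    (hlt : ∑ i : Fin m, n i.castSucc < n (Fin.last m)) (k : (i : Fin (m + 1)) → Fin (n i + 1))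
    (J₀ : MultiIndex n d) : ∃ R : MvPolynomial {J : MultiIndex n d // J ≠ J₀} ℂ, R ≠ 0 ∧
      ∀ y H, IsSingularAt k H y → eval (fun J => H J.1) R = 0 := by
  classical
  -- The monomial z_a, with all other factors at the base. It has coefficient 1 in the equation
  -- a_a(y) = 0 and does not occur in the others, which gives the echelon form.
  let κ : Fin (n (Fin.last m) + 1) → MultiIndex n d := fun a =>
    Function.update (baseIndex d k) (Fin.last m) (Sym.mk {a} (by simp [h1]))
  have hκ : ∀ a, lastElem h1 (κ a) = a := by
    intro a
    have h2 := coe_last_eq h1 (κ a)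
    simp only [κ, Function.update_self, Sym.coe_mk, Multiset.singleton_inj] at h2
    exact h2.symm
  have hκ' : ∀ a, initPoly k (κ a) = 1 := by
    intro a
    have h2 : (fun i : Fin m => κ a i.castSucc) =
        baseIndex (n := fun i : Fin m => n i.castSucc) (fun i : Fin m => d i.castSucc)
          fun i => k i.castSucc := by
      funext i
      simp only [κ]
      rw [Function.update_of_ne (Fin.castSucc_lt_last i).ne]
      rfl
    rw [initPoly, h2, monomialPoly_baseIndex]
  obtain ⟨R, hR0, hR⟩ := exists_eval_eq_zero_of_card_lt κ
    (Subtype.val : {J : MultiIndex n d // J ≠ J₀} → MultiIndex n d)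
    (fun a J => if a = lastElem h1 J then initPoly k J else 0)
    (fun a b => by rw [hκ, hκ']) (by
      -- There are n_r + 1 equations; the extra one pays for the dropped coefficient `J₀`, and what
      -- remains is `hlt`.
      have h3 := Fintype.card_congr (Equiv.optionSubtypeNe J₀)
      rw [Fintype.card_option] at h3
      rw [← h3, Fintype.card_fin, Fintype.card_sigma]
      simp only [Fintype.card_fin]
      omega)
  refine ⟨R, hR0, fun y H hs => hR (fun u => y (initIndex u)) H fun a => ?_⟩
  rw [isSingularAt_iff_lastCoeff h1] at hs
  rw [← hs.1 a, lastCoeff, map_sum]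
  refine Finset.sum_congr rfl fun J _ => ?_
  split_ifs
  · rw [map_mul, eval_C, mul_comm]
  · simp

/-- Let P be a prime factor of F and `J₀` a variable occurring in P. An equation free of `J₀`
vanishes on the dual variety, so by the Nullstellensatz P divides it, which contradicts the degrees
in `J₀`. -/
theorem not_isHypersurface_of_lt (hn : ∀ i, 0 < n i) (hd : ∀ i, 0 < d i)
    (h1 : d (Fin.last m) = 1) (hlt : ∑ i : Fin m, n i.castSucc < n (Fin.last m)) :
    ¬ IsHypersurface (dualVariety (segreVeronese n d)) := by
  classical
  rintro ⟨F, e, he, hF0, hF, hdual⟩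
  have hFu : ¬ IsUnit F := by
    intro hu
    obtain ⟨c, -, rfl⟩ := MvPolynomial.isUnit_iff_eq_C_of_isReduced.mp hu
    exact he.ne' (hF.inj_right (isHomogeneous_C _ c) hF0)
  obtain ⟨P, hPirr, hPF⟩ := WfDvdMonoid.exists_irreducible_factor hFu hF0
  have hP : Prime P := hPirr.prime
  obtain ⟨J₀, hJ₀⟩ : ∃ J₀, J₀ ∈ P.vars := by
    by_contra hcon
    push Not at hcon
    have h2 : P = C (coeff 0 P) := by
      rw [← MvPolynomial.vars_eq_empty_iff_eq_C]
      exact Finset.eq_empty_of_forall_notMem hcon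
    apply hPirr.not_isUnit
    rw [h2]
    refine IsUnit.map C (IsUnit.mk0 _ fun h0 => hP.ne_zero ?_)
    rw [h2, h0, C_0]
  let k : (i : Fin (m + 1)) → Fin (n i + 1) := fun _ => 0
  obtain ⟨J₁, hJ₁⟩ : ∃ J₁ : MultiIndex n d, J₁ ≠ J₀ := by
    by_contra hcon
    push Not at hcon
    exact coordIndex_ne_baseIndex hd k ⟨Fin.last m, ⟨0, hn _⟩⟩
      ((hcon _).trans (hcon _).symm)
  obtain ⟨R, hR0, hR⟩ := exists_equation_without_variable h1 hlt k J₀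
  obtain ⟨e', he'⟩ := exists_homogeneousComponent_ne_zero hR0
  -- The factor X makes R' vanish at the origin, which lies on the affine zero locus of F but gives
  -- no projective point.
  set R' : MvPolynomial {J : MultiIndex n d // J ≠ J₀} ℂ :=
    X ⟨J₁, hJ₁⟩ * homogeneousComponent e' R with hR'
  have hR'0 : R' ≠ 0 := mul_ne_zero (X_ne_zero _) he'
  have hhom : (rename Subtype.val R').IsHomogeneous (1 + e') :=
    IsHomogeneous.rename_isHomogeneous
      ((isHomogeneous_X _ _).mul (homogeneousComponent_isHomogeneous e' R))
  have hvan : ∀ y H, IsSingularAt k H y → eval H (rename Subtype.val R') = 0 := by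
    intro y H hs
    rw [eval_rename, hR', map_mul]
    apply mul_eq_zero_of_right
    refine eval_homogeneousComponent_eq_zero (fun c => ?_) e'
    have hc : c • (H ∘ Subtype.val) = fun J : {J : MultiIndex n d // J ≠ J₀} => (c • H) J.1 := rfl
    rw [hc]
    exact hR y (c • H) (hs.smul c)
  have hrad : rename Subtype.val R' ∈ (Ideal.span {F}).radical := by
    rw [← MvPolynomial.vanishingIdeal_zeroLocus_eq_radical (K := ℂ)]
    rw [MvPolynomial.mem_vanishingIdeal_iff]
    intro v hv
    rw [MvPolynomial.zeroLocus_span] at hv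
    have hFv : eval v F = 0 := by simpa [aeval_eq_eval] using hv
    rw [aeval_eq_eval]
    change eval v _ = 0
    by_cases hv0 : v = 0
    · rw [hv0, eval_rename, hR', map_mul, eval_X]
      simp
    · rw [← eval_rep_mk_eq_zero_iff hhom v hv0]
      have hmem : Projectivization.mk ℂ v hv0 ∈ dualVariety (segreVeronese n d) := by
        rw [hdual]
        exact (eval_rep_mk_eq_zero_iff hF v hv0).mpr hFv
      rw [mem_dualVariety_iff hd] at hmem
      exact hmem _ _ hhom fun k' y H _ hs => eval_eq_zero_of_isSingularAt hd k hvan hs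
  obtain ⟨N, hN⟩ := hrad
  rw [Ideal.mem_span_singleton] at hN
  obtain ⟨Q, hQ⟩ := hP.dvd_of_dvd_pow (hPF.trans hN)
  have hne : rename Subtype.val R' ≠ 0 := by
    rw [Ne, ← map_zero (rename Subtype.val), (rename_injective _ Subtype.val_injective).eq_iff]
    exact hR'0
  have hQ0 : Q ≠ 0 := by
    rintro rfl
    exact hne (by rw [hQ, mul_zero])
  have hdeg := degreeOf_mul_eq (n := J₀) hP.ne_zero hQ0
  have hJ₀' := mem_vars_iff_degreeOf_ne_zero.mp hJ₀
  have hR₀ : degreeOf J₀ (rename Subtype.val R') = 0 := by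
    by_contra hmem
    rw [← Ne, ← mem_vars_iff_degreeOf_ne_zero] at hmem
    obtain ⟨J, -, hJ⟩ := Finset.mem_image.mp (vars_rename _ _ hmem)
    exact J.2 hJ
  rw [← hQ] at hdeg
  omega

end LinearLastFactor

/-! ### A nondegenerate quadric, and isolated singularities. -/

section Quadric

open MvPolynomial

/-- A cyclic shift that moves every element by at least half of the length. -/
theorem exists_perm_fin (T : ℕ) (hT : 0 < T) : ∃ s : Equiv.Perm (Fin T),
    (∀ a : Fin T, a.val + T / 2 ≤ (s a).val ∨ (s a).val + T / 2 ≤ a.val) ∧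
      ∀ f : Fin T → ℂ, (∀ a, f (s a) + f (s.symm a) = 0) → f = 0 := by
  have : NeZero T := ⟨hT.ne'⟩
  let c : Fin T := ⟨T / 2, Nat.div_lt_self hT one_lt_two⟩
  refine ⟨Equiv.addRight c, fun a => ?_, fun f hf => ?_⟩
  · have h1 : (Equiv.addRight c a).val = (a.val + T / 2) % T := rfl
    rw [h1]
    have ha := a.2
    rcases Nat.lt_or_ge (a.val + T / 2) T with h | h
    · rw [Nat.mod_eq_of_lt h]
      exact Or.inl le_rfl
    -- Wrapping around moves a down by T - T / 2, which is at least T / 2 because division rounds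
    -- down.
    · rw [Nat.mod_eq_sub_mod h, Nat.mod_eq_of_lt (by omega)]
      right
      omega
  · have h1 : ∀ x, f (x + (c + c)) = - f x := by
      intro x
      have h2 := hf (x + c)
      simp only [Equiv.coe_addRight, Equiv.addRight_symm, add_neg_cancel_right] at h2
      rw [← add_assoc]
      exact eq_neg_of_add_eq_zero_left h2
    have h2 : ∀ (j : ℕ) x, f (x + j • (c + c)) = (-1) ^ j * f x := by
      intro j
      induction j with
      | zero => simp
      | succ j ih =>
        intro x
        rw [succ_nsmul, ← add_assoc, h1, ih, pow_succ]
        ring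
    -- Twice the shift is zero for even T, and is killed by the odd number T otherwise. Either way
    -- an odd number of sign changes returns to x, so f x = -f x.
    have key : ∃ j : ℕ, Odd j ∧ j • (c + c) = 0 := by
      rcases Nat.even_or_odd T with he | ho
      · refine ⟨1, odd_one, ?_⟩
        rw [one_nsmul]
        apply Fin.ext
        change (T / 2 + T / 2) % T = 0 % T
        obtain ⟨t, rfl⟩ := he
        rw [show (t + t) / 2 + (t + t) / 2 = t + t by omega]
        simp
      · refine ⟨T, ho, ?_⟩
        have := card_nsmul_eq_zero (x := c + c)
        rwa [Fintype.card_fin] at this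
    obtain ⟨j, hj, hj0⟩ := key
    funext x
    have h3 := h2 j x
    rw [hj0, add_zero, hj.neg_one_pow] at h3
    have h4 : (2 : ℂ) * f x = 0 := by linear_combination h3
    simpa using h4

variable {r : ℕ} {n d : Fin r → ℕ}

/-- `finSigmaFinEquiv` lays the factors out as consecutive intervals. If d i = 1, the interval has
at most half the total length, so two of its members are closer together than the shift moves
anything. -/
theorem exists_perm_affineIndex (hT : 0 < ∑ i, n i)
    (hnd : ∀ i, d i = 1 → 2 * n i ≤ ∑ j, n j) (hd : ∀ i, 0 < d i) :
    ∃ s : Equiv.Perm (AffineIndex n), (∀ u, u.1 = (s u).1 → 2 ≤ d u.1) ∧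
      ∀ f : AffineIndex n → ℂ, (∀ u, f (s u) + f (s.symm u) = 0) → f = 0 := by
  obtain ⟨s, hs1, hs2⟩ := exists_perm_fin _ hT
  let e : AffineIndex n ≃ Fin (∑ i, n i) := finSigmaFinEquiv
  refine ⟨(e.trans s).trans e.symm, fun u hu => ?_, fun f hf => ?_⟩
  · by_contra hlt
    have h1 : d u.1 = 1 := by
      have := hd u.1
      omega
    have h2 := hnd _ h1
    generalize hv : ((e.trans s).trans e.symm) u = v at hu
    have hv' : s (e u) = e v := by
      rw [← hv]
      simp
    have h3 := hs1 (e u)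
    rw [hv'] at h3
    obtain ⟨i, a⟩ := u
    obtain ⟨j, b⟩ := v
    obtain rfl : i = j := hu
    have ha := finSigmaFinEquiv_apply (n := n) ⟨i, a⟩
    have hb := finSigmaFinEquiv_apply (n := n) ⟨i, b⟩
    simp only at ha hb h2
    change ((finSigmaFinEquiv (n := n) ⟨i, a⟩ : Fin _) : ℕ) + _ ≤
      ((finSigmaFinEquiv (n := n) ⟨i, b⟩ : Fin _) : ℕ) ∨
      ((finSigmaFinEquiv (n := n) ⟨i, b⟩ : Fin _) : ℕ) + _ ≤
      ((finSigmaFinEquiv (n := n) ⟨i, a⟩ : Fin _) : ℕ) at h3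
    rw [ha, hb] at h3
    have := a.2
    have := b.2
    omega
  · have h1 := hs2 (fun a => f (e.symm a)) fun a => by
      have := hf (e.symm a)
      simpa using this
    funext u
    have := congrFun h1 (e u)
    simpa using this

/-- The Hessian matrix of a form at a point of a chart. -/
def hessian (k : (i : Fin r) → Fin (n i + 1)) (H : MultiIndex n d → ℂ)
    (y : AffineIndex n → ℂ) : Matrix (AffineIndex n) (AffineIndex n) ℂ :=
  Matrix.of fun u w => eval y (pderiv w (pderiv u (formPoly k H)))

theorem hessian_singularPart (hd : ∀ i, 0 < d i) (k : (i : Fin r) → Fin (n i + 1))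
    (H : MultiIndex n d → ℂ) (y z : AffineIndex n → ℂ) :
    hessian k (singularPart hd k y H) z = hessian k H z := by
  ext u w
  simp [hessian, pderiv_formPoly_singularPart]

theorem ne_zero_of_hessian_ne_zero (hT : 0 < ∑ i, n i) {k : (i : Fin r) → Fin (n i + 1)}
    {H : MultiIndex n d → ℂ} {y : AffineIndex n → ℂ} (h : (hessian k H y).det ≠ 0) : H ≠ 0 := by
  intro h0
  apply h
  have hcard : Nonempty (AffineIndex n) := by
    rw [← Fintype.card_pos_iff, Fintype.card_sigma]
    simpa using hT
  have : hessian k H y = 0 := by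
    ext u w
    simp [hessian, formPoly, h0]
  rw [this, Matrix.det_zero]

/-- The form is ∑ x_u x_{s(u)}. Its Hessian is P + P⁻¹ for the permutation matrix P of s,
independent of y, and the choice of s makes it injective. -/
theorem exists_hessian_ne_zero (hT : 0 < ∑ i, n i)
    (hnd : ∀ i, d i = 1 → 2 * n i ≤ ∑ j, n j) (hd : ∀ i, 0 < d i)
    (k : (i : Fin r) → Fin (n i + 1)) :
    ∃ H : MultiIndex n d → ℂ, ∀ y, (hessian k H y).det ≠ 0 := by
  classical
  obtain ⟨s, hs1, hs2⟩ := exists_perm_affineIndex hT hnd hd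
  choose J hJ using fun u => exists_monomialPoly_eq_mul hd k u (s u) (hs1 u)
  -- Different u may yield the same monomial, so the coefficient counts them.
  let H : MultiIndex n d → ℂ := fun I => ∑ u, if I = J u then 1 else 0
  have hform : formPoly k H = ∑ u, X u * X (s u) := by
    simp only [formPoly, H, map_sum, Finset.sum_mul]
    rw [Finset.sum_comm]
    refine Finset.sum_congr rfl fun u _ => ?_
    rw [Finset.sum_eq_single (J u)]
    · simp [hJ]
    · intro I _ hI
      simp [hI]
    · simp
  have hder : ∀ u, pderiv u (formPoly k H) = X (s u) + X (s.symm u) := by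
    intro u
    rw [hform, map_sum]
    simp only [Derivation.leibniz, smul_eq_mul, pderiv_X, Finset.sum_add_distrib]
    rw [add_comm]
    congr 1
    · rw [Finset.sum_eq_single u]
      · simp
      · intro v _ hv
        simp [Pi.single_eq_of_ne hv]
      · simp
    · rw [Finset.sum_eq_single (s.symm u)]
      · simp
      · intro v _ hv
        have : s v ≠ u := fun h => hv (by rw [← h, Equiv.symm_apply_apply])
        simp [Pi.single_eq_of_ne this]
      · simp
  refine ⟨H, fun y hdet => ?_⟩
  obtain ⟨f, hf0, hf⟩ := Matrix.exists_mulVec_eq_zero_iff.mpr hdet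
  refine hf0 (hs2 f fun u => ?_)
  have h1 := congrFun hf u
  simp only [Matrix.mulVec, dotProduct, hessian, Matrix.of_apply, hder, map_add, pderiv_X,
    add_mul, Finset.sum_add_distrib, Pi.zero_apply] at h1
  rw [← h1]
  congr 1
  · rw [Finset.sum_eq_single (s u)]
    · simp
    · intro v _ hv
      simp [Pi.single_eq_of_ne (Ne.symm hv)]
    · simp
  · rw [Finset.sum_eq_single (s.symm u)]
    · simp
    · intro v _ hv
      simp [Pi.single_eq_of_ne (Ne.symm hv)]
    · simp

/-- A nondegenerate quadratic singularity is isolated. -/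
theorem subset_singleton_of_hessian_ne_zero (hd : ∀ i, 0 < d i)
    {k : (i : Fin r) → Fin (n i + 1)} {H : PSpace (MultiIndex n d)} {y : AffineIndex n → ℂ}
    (hs : IsSingularAt k H.rep y) (hdet : (hessian k H.rep y).det ≠ 0)
    {W : Set (PSpace (MultiIndex n d))} (hW : IsIrreducible W)
    (hWt : W ⊆ tangencyLocus (segreVeronese n d) H) (hx : chartPoint d k y ∈ W) :
    W ⊆ {chartPoint d k y} := by
  classical
  -- Write ∂_u f = ∑_w q_{uw} (x_w - y_w), where q at y is the Hessian. Wherever det q ≠ 0, the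
  -- derivatives have no common zero other than y.
  choose q hq hq' using fun u => exists_first_order_expansion y (pderiv u (formPoly k H.rep))
  let M : Matrix (AffineIndex n) (AffineIndex n) (MvPolynomial (AffineIndex n) ℂ) :=
    Matrix.of fun u w => q u w
  have hMeval : ∀ z, eval z M.det = ((eval z).mapMatrix M).det := fun z => RingHom.map_det _ _
  -- The points outside the chart go into this closed set too, so that it covers W together with the
  -- single point; the point itself is not in it.
  let C₁ : Set (PSpace (MultiIndex n d)) := {p | p.rep (baseIndex d k) = 0 ∨
    eval (fun u => p.rep (coordIndex hd k u) / p.rep (baseIndex d k)) M.det = 0}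
  have hC₁ : IsClosed C₁ := isClosed_chart_zero _ _ _
  have hcover : W ⊆ C₁ ∪ {chartPoint d k y} := by
    intro p hp
    by_cases h0 : p.rep (baseIndex d k) = 0
    · exact Or.inl (Or.inl h0)
    obtain ⟨hpX, hpt⟩ := hWt hp
    obtain ⟨z, rfl⟩ := exists_eq_chartPoint_of_rep_ne_zero hd k hpX h0
    rw [isTangentAt_chartPoint_iff hd] at hpt
    by_cases hz : eval z M.det = 0
    · refine Or.inl (Or.inr ?_)
      simpa only [rep_chartPoint_div] using hz
    · right
      rw [hMeval] at hz
      have h1 : ((eval z).mapMatrix M).mulVec (fun u => z u - y u) = 0 := by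
        funext u
        have h2 := congrArg (eval z) (hq u)
        rw [hpt.2 u, hs.2 u] at h2
        simp only [map_sum, map_mul, map_sub, eval_X, eval_C, map_zero, zero_add] at h2
        exact h2.symm
      have h3 := Matrix.eq_zero_of_mulVec_eq_zero hz h1
      have h4 : z = y := funext fun u => sub_eq_zero.mp (congrFun h3 u)
      rw [h4]
      rfl
  rcases isPreirreducible_iff_isClosed_union_isClosed.mp hW.2 _ _ hC₁ isClosed_singleton hcover
    with h | h
  · exfalso
    rcases h hx with h0 | h0
    · exact rep_chartPoint_baseIndex_ne_zero k y h0
    · simp only [rep_chartPoint_div] at h0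
      rw [hMeval] at h0
      apply hdet
      rw [← h0]
      congr 1
      ext u w
      simp [hessian, M, hq']
  · exact h

theorem isClosed_hessian_eq_zero (k : (i : Fin r) → Fin (n i + 1)) (y : AffineIndex n → ℂ) :
    IsClosed {H : PSpace (MultiIndex n d) | (hessian k H.rep y).det = 0} := by
  classical
  let M : Matrix (AffineIndex n) (AffineIndex n) (MvPolynomial (MultiIndex n d) ℂ) :=
    Matrix.of fun u w => ∑ J, C (eval y (pderiv w (pderiv u (monomialPoly k J)))) * X J
  have hM : M.det.IsHomogeneous (Fintype.card (AffineIndex n)) := by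
    rw [Matrix.det_apply']
    refine IsHomogeneous.sum _ _ _ fun s _ => ?_
    have h1 : (∏ u, M (s u) u).IsHomogeneous (∑ u : AffineIndex n, 1) :=
      IsHomogeneous.prod _ _ _ fun u _ => IsHomogeneous.sum _ _ _ fun J _ =>
        isHomogeneous_C_mul_X _ _
    rw [Finset.sum_const, Finset.card_univ, smul_eq_mul, mul_one] at h1
    have h2 := h1.C_mul ((Equiv.Perm.sign s : ℤ) : ℂ)
    simpa using h2
  convert isClosed_setOf_eval_eq_zero hM using 3 with H
  rw [RingHom.map_det]
  congr! 2
  ext u w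
  simp [hessian, M, formPoly, mul_comm]

/-- Passing to the singular part subtracts an affine-linear polynomial and keeps the Hessian, so
some hyperplane tangent at x has nondegenerate Hessian. This condition is open, hence met by any
dense set of tangent hyperplanes. -/
theorem not_isOneWeaklyDefective (hT : 0 < ∑ i, n i)
    (hnd : ∀ i, d i = 1 → 2 * n i ≤ ∑ j, n j) (hd : ∀ i, 0 < d i) :
    ¬ IsOneWeaklyDefective (segreVeronese n d) := by
  classical
  rintro ⟨U, -, hUd, hU⟩
  obtain ⟨x, hxU, hx⟩ : (U ∩ segreVeronese n d).Nonempty := by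
    rw [← closure_nonempty_iff]
    exact ⟨_, hUd (chartPoint_mem (fun _ => 0) 0)⟩
  obtain ⟨U', -, hUd', hU'⟩ := hU x ⟨hxU, hx⟩
  obtain ⟨k, y, rfl⟩ := exists_eq_chartPoint hx
  obtain ⟨Hq, hHq⟩ := exists_hessian_ne_zero hT hnd hd k
  set H₀ := singularPart hd k y Hq with hH₀
  have hdet : ∀ z, (hessian k H₀ z).det ≠ 0 := fun z => by
    rw [hH₀, hessian_singularPart]
    exact hHq z
  have hdet' : ∀ c : ℂ, c ≠ 0 → (hessian k (c • H₀) y).det ≠ 0 := by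
    intro c hc
    have h1 : hessian k (c • H₀) y = c • hessian k H₀ y := by
      ext u w
      simp [hessian, formPoly, Finset.mul_sum, mul_assoc]
    rw [h1, Matrix.det_smul]
    exact mul_ne_zero (pow_ne_zero _ hc) (hdet y)
  have hne : H₀ ≠ 0 := ne_zero_of_hessian_ne_zero hT (hdet y)
  have hs : ∀ c : ℂ, IsSingularAt k (c • H₀) y :=
    fun c => (isSingularAt_singularPart hd k y Hq).smul c
  obtain ⟨c, hc, hrep⟩ := exists_rep_mk H₀ hne
  have hmem : Projectivization.mk ℂ H₀ hne ∈
      tangentHyperplanes (segreVeronese n d) (chartPoint d k y) := by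
    refine (isTangentAt_chartPoint_iff hd k _ y).mpr ?_
    rw [hrep]
    exact hs c
  have hopen : IsOpen {H : PSpace (MultiIndex n d) | (hessian k H.rep y).det = 0}ᶜ :=
    (isClosed_hessian_eq_zero k y).isOpen_compl
  obtain ⟨H, hH, hHU⟩ := mem_closure_iff.mp (hUd' hmem) _ hopen (by
    change ¬ _ = _
    rw [hrep]
    exact hdet' c hc)
  refine topologicalKrullDim_contactLocus_not_pos (fun W hW hWt hxW => ?_) (hU' H hHU)
  exact subset_singleton_of_hessian_ne_zero hd
    ((isTangentAt_chartPoint_iff hd k H y).mp hHU.2) hH hW hWt hxW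

end Quadric

/-! ### The ideal of the dual variety is principal. -/

section DualHypersurface

open MvPolynomial

variable {r : ℕ} {n d : Fin r → ℕ}

/-- The generic form of multidegree `d`. -/
def genericForm (d : Fin r → ℕ) (k : (i : Fin r) → Fin (n i + 1)) :
    MvPolynomial (AffineIndex n ⊕ MultiIndex n d) ℂ :=
  ∑ J : MultiIndex n d, X (Sum.inr J) * rename Sum.inl (monomialPoly k J)

/-- The derivatives of the generic form of multidegree `d`. -/
def genericDeriv (d : Fin r → ℕ) (k : (i : Fin r) → Fin (n i + 1)) (u : AffineIndex n) :
    MvPolynomial (AffineIndex n ⊕ MultiIndex n d) ℂ :=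
  ∑ J : MultiIndex n d, X (Sum.inr J) * rename Sum.inl (pderiv u (monomialPoly k J))

/-- The coefficients of the generic form with a singularity at the generic point of a chart. -/
def genericSingular (hd : ∀ i, 0 < d i) (k : (i : Fin r) → Fin (n i + 1)) (J : MultiIndex n d) :
    MvPolynomial (AffineIndex n ⊕ MultiIndex n d) ℂ :=
  X (Sum.inr J) - ∑ u, (if J = coordIndex hd k u then genericDeriv d k u else 0) -
    (if J = baseIndex d k then
      genericForm d k - ∑ u, X (Sum.inl u) * genericDeriv d k u else 0)

theorem eval_genericForm (k : (i : Fin r) → Fin (n i + 1)) (y : AffineIndex n → ℂ)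
    (H : MultiIndex n d → ℂ) :
    eval (Sum.elim y H) (genericForm d k) = eval y (formPoly k H) := by
  simp [genericForm, formPoly, eval_rename, Function.comp_def]

theorem eval_genericDeriv (k : (i : Fin r) → Fin (n i + 1)) (y : AffineIndex n → ℂ)
    (H : MultiIndex n d → ℂ) (u : AffineIndex n) :
    eval (Sum.elim y H) (genericDeriv d k u) = eval y (pderiv u (formPoly k H)) := by
  simp [genericDeriv, formPoly, eval_rename, Function.comp_def]

theorem eval_genericSingular (hd : ∀ i, 0 < d i) (k : (i : Fin r) → Fin (n i + 1))
    (y : AffineIndex n → ℂ) (H : MultiIndex n d → ℂ) (J : MultiIndex n d) :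
    eval (Sum.elim y H) (genericSingular hd k J) = singularPart hd k y H J := by
  simp only [genericSingular, singularPart, map_sub, map_sum, eval_X, Sum.elim_inr,
    apply_ite (eval (Sum.elim y H)), map_zero, map_mul, Sum.elim_inl, eval_genericForm,
    eval_genericDeriv]

/-- The ideal of the cone over the dual variety. -/
def dualIdeal (hd : ∀ i, 0 < d i) (k : (i : Fin r) → Fin (n i + 1)) :
    Ideal (MvPolynomial (MultiIndex n d) ℂ) :=
  RingHom.ker (aeval (genericSingular hd k) : MvPolynomial (MultiIndex n d) ℂ →ₐ[ℂ] _)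

instance (hd : ∀ i, 0 < d i) (k : (i : Fin r) → Fin (n i + 1)) : (dualIdeal hd k).IsPrime :=
  RingHom.ker_isPrime _

/-- The generic coefficients specialize to `singularPart`, which is singular at y and fixes every
form already singular there. Their values are thus exactly the singular forms of the chart. -/
theorem mem_dualIdeal_iff (hd : ∀ i, 0 < d i) (k : (i : Fin r) → Fin (n i + 1))
    {G : MvPolynomial (MultiIndex n d) ℂ} :
    G ∈ dualIdeal hd k ↔ ∀ y H, IsSingularAt k H y → eval H G = 0 := by
  have heval : ∀ y H, eval (Sum.elim y H) (aeval (genericSingular hd k) G) =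
      eval (singularPart hd k y H) G := by
    intro y H
    rw [eval_aeval]
    simp only [eval_genericSingular]
  rw [dualIdeal, RingHom.mem_ker]
  constructor
  · intro h y H hs
    have h1 := heval y H
    rw [singularPart_of_isSingularAt hd hs] at h1
    rw [← h1]
    erw [h]
    exact map_zero _
  · intro h
    apply MvPolynomial.funext
    intro x
    rw [map_zero]
    have h1 := heval (x ∘ Sum.inl) (x ∘ Sum.inr)
    rw [Sum.elim_comp_inl_inr, h _ _ (isSingularAt_singularPart hd k _ _)] at h1
    exact h1

/-- Singularity imposes one condition more than there are affine coordinates to choose the singular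
point. -/
theorem dualIdeal_ne_bot (hd : ∀ i, 0 < d i) (k : (i : Fin r) → Fin (n i + 1)) :
    dualIdeal hd k ≠ ⊥ := by
  classical
  let κ : Option (AffineIndex n) → MultiIndex n d :=
    fun v => v.elim (baseIndex d k) (coordIndex hd k)
  -- Subtracting ∑ x_u ∂_u from the value condition removes the coefficients at the `coordIndex`
  -- monomials and gives the echelon form.
  let e : Option (AffineIndex n) → MultiIndex n d → MvPolynomial (AffineIndex n) ℂ := fun v J =>
    v.elim (monomialPoly k J - ∑ u, X u * pderiv u (monomialPoly k J))
      fun u => pderiv u (monomialPoly k J)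
  have he : ∀ v v', e v (κ v') = if v = v' then 1 else 0 := by
    rintro (_ | u) (_ | u')
    · simp [e, κ]
    · simp only [e, κ, Option.elim_none, Option.elim_some, monomialPoly_coordIndex]
      rw [Finset.sum_eq_single u']
      · simp
      · intro v _ hv
        rw [pderiv_X_of_ne (Ne.symm hv), mul_zero]
      · simp
    · simp [e, κ]
    · simp only [e, κ, Option.elim_some, monomialPoly_coordIndex, Option.some.injEq]
      split_ifs with h
      · rw [h, pderiv_X_self]
      · rw [pderiv_X_of_ne (Ne.symm h)]
  obtain ⟨R, hR0, hR⟩ := exists_eval_eq_zero_of_card_lt κ (id : MultiIndex n d → MultiIndex n d)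
    e he (by
      rw [Fintype.card_option]
      omega)
  intro hbot
  apply hR0
  have hmem : R ∈ dualIdeal hd k := by
    rw [mem_dualIdeal_iff]
    intro y H hs
    refine hR y H ?_
    have hder : ∀ u, ∑ J, eval y (pderiv u (monomialPoly k J)) * H J = 0 := by
      intro u
      rw [← hs.2 u, eval_pderiv_formPoly]
      exact Finset.sum_congr rfl fun J _ => mul_comm _ _
    rintro (_ | u)
    · simp only [e, Option.elim_none, map_sub, map_sum, map_mul, eval_X, sub_mul,
        Finset.sum_sub_distrib, Finset.sum_mul]
      have h1 : ∑ J, eval y (monomialPoly k J) * H J = 0 := by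
        rw [← hs.1, eval_formPoly]
        exact Finset.sum_congr rfl fun J _ => mul_comm _ _
      rw [h1, Finset.sum_comm, zero_sub, neg_eq_zero]
      refine Finset.sum_eq_zero fun u _ => ?_
      simp only [mul_assoc, ← Finset.mul_sum]
      rw [hder, mul_zero]
    · exact hder u
  rw [hbot] at hmem
  exact hmem

theorem pderiv_inl_genericSingular (hd : ∀ i, 0 < d i) (k : (i : Fin r) → Fin (n i + 1))
    (w : AffineIndex n) (J : MultiIndex n d) (hJ : J ≠ baseIndex d k) :
    pderiv (Sum.inl w) (genericSingular hd k J) =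
      - ∑ u, (if J = coordIndex hd k u then pderiv (Sum.inl w) (genericDeriv d k u) else 0) := by
  rw [genericSingular, if_neg hJ, sub_zero, map_sub, pderiv_X_of_ne (by simp), zero_sub, map_sum]
  simp only [apply_ite, map_zero]

theorem pderiv_inr_genericSingular (hd : ∀ i, 0 < d i) (k : (i : Fin r) → Fin (n i + 1))
    (I J : MultiIndex n d) (hJ : J ≠ baseIndex d k) :
    pderiv (Sum.inr I) (genericSingular hd k J) = (if J = I then 1 else 0) -
      ∑ u, (if J = coordIndex hd k u then pderiv (Sum.inr I) (genericDeriv d k u) else 0) := by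
  rw [genericSingular, if_neg hJ, sub_zero, map_sub, map_sum]
  simp only [apply_ite, map_zero]
  congr 1
  split_ifs with h
  · rw [h, pderiv_X_self]
  · exact pderiv_X_of_ne (by simpa using h)

theorem eval_pderiv_genericDeriv (k : (i : Fin r) → Fin (n i + 1)) (y : AffineIndex n → ℂ)
    (H : MultiIndex n d → ℂ) (u w : AffineIndex n) :
    eval (Sum.elim y H) (pderiv (Sum.inl w) (genericDeriv d k u)) = hessian k H y u w := by
  simp [genericDeriv, hessian, formPoly, pderiv_rename Sum.inl_injective, eval_rename,
    Function.comp_def, Derivation.leibniz]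

/-- If some Hessian is nondegenerate, the dual ideal is stable under differentiation of
polynomials that do not involve the base coefficient. -/
theorem pderiv_mem_dualIdeal (hd : ∀ i, 0 < d i) (k : (i : Fin r) → Fin (n i + 1))
    {H₀ : MultiIndex n d → ℂ} (hH₀ : (hessian k H₀ 0).det ≠ 0)
    {R : MvPolynomial (MultiIndex n d) ℂ} (hR : R ∈ dualIdeal hd k)
    (hR0 : pderiv (baseIndex d k) R = 0) (I : MultiIndex n d) : pderiv I R ∈ dualIdeal hd k := by
  classical
  set ρ : MultiIndex n d → MvPolynomial (AffineIndex n ⊕ MultiIndex n d) ℂ :=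
    fun J => aeval (genericSingular hd k) (pderiv J R) with hρ
  have hρ0 : ρ (baseIndex d k) = 0 := by rw [hρ]; simp only [hR0, map_zero]
  have hR' : aeval (genericSingular hd k) R = 0 := hR
  have hchain : ∀ t, ∑ J, ρ J * pderiv t (genericSingular hd k J) = 0 := by
    intro t
    rw [← pderiv_aeval, hR', map_zero]
  have hpick : ∀ g : AffineIndex n → MvPolynomial (AffineIndex n ⊕ MultiIndex n d) ℂ,
      ∑ J, ρ J * ∑ u, (if J = coordIndex hd k u then g u else 0) =
        ∑ u, ρ (coordIndex hd k u) * g u := by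
    intro g
    simp only [Finset.mul_sum]
    rw [Finset.sum_comm]
    refine Finset.sum_congr rfl fun u _ => ?_
    simp
  let M : Matrix (AffineIndex n) (AffineIndex n)
      (MvPolynomial (AffineIndex n ⊕ MultiIndex n d) ℂ) :=
    Matrix.of fun u w => pderiv (Sum.inl w) (genericDeriv d k u)
  have hM : M.det ≠ 0 := by
    intro h0
    apply hH₀
    have h1 := congrArg (eval (Sum.elim 0 H₀)) h0
    rw [map_zero, RingHom.map_det] at h1
    rw [← h1]
    congr 1
    ext u w
    exact (eval_pderiv_genericDeriv k 0 H₀ u w).symm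
  -- Differentiate the relation in the coordinates of the singular point. The base term drops out
  -- since ρ vanishes there, and only the coefficients at `coordIndex` depend on the point; they
  -- contribute the generic Hessian, which is invertible over the fraction field.
  have hcoord : ∀ u, ρ (coordIndex hd k u) = 0 := by
    have h1 : Matrix.vecMul (fun u => ρ (coordIndex hd k u)) M = 0 := by
      funext w
      have h2 := hchain (Sum.inl w)
      have h3 : ∀ J, ρ J * pderiv (Sum.inl w) (genericSingular hd k J) =
          - (ρ J * ∑ u, (if J = coordIndex hd k u then
            pderiv (Sum.inl w) (genericDeriv d k u) else 0)) := by
        intro J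
        by_cases hJ : J = baseIndex d k
        · rw [hJ, hρ0, zero_mul, zero_mul, neg_zero]
        · rw [pderiv_inl_genericSingular hd k w J hJ, mul_neg]
      simp only [h3, Finset.sum_neg_distrib, hpick, neg_eq_zero] at h2
      exact h2
    exact congrFun (Matrix.eq_zero_of_vecMul_eq_zero hM h1)
  -- Differentiating in the coefficient I now leaves only ρ I.
  have h2 := hchain (Sum.inr I)
  have h3 : ∀ J, ρ J * pderiv (Sum.inr I) (genericSingular hd k J) =
      (if J = I then ρ J else 0) - ρ J * ∑ u, (if J = coordIndex hd k u then
        pderiv (Sum.inr I) (genericDeriv d k u) else 0) := by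
    intro J
    by_cases hJ : J = baseIndex d k
    · rw [hJ, hρ0, zero_mul, zero_mul, ite_self, sub_zero]
    · rw [pderiv_inr_genericSingular hd k I J hJ, mul_sub, mul_ite, mul_one, mul_zero]
  simp only [h3, Finset.sum_sub_distrib, hpick, hcoord, zero_mul, Finset.sum_const_zero,
    sub_zero, Finset.sum_ite_eq', Finset.mem_univ, if_true] at h2
  exact h2

/-- Derivatives stay in the ideal, remain free of the base coefficient and have smaller degree, so
by induction they vanish. A constant in the ideal is zero because it vanishes at some singular form.
-/
theorem eq_zero_of_mem_dualIdeal (hd : ∀ i, 0 < d i) (k : (i : Fin r) → Fin (n i + 1))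
    {H₀ : MultiIndex n d → ℂ} (hH₀ : (hessian k H₀ 0).det ≠ 0) (N : ℕ) :
    ∀ R ∈ dualIdeal hd k, pderiv (baseIndex d k) R = 0 → R.totalDegree ≤ N → R = 0 := by
  have hconst : ∀ R ∈ dualIdeal hd k, (∀ J, pderiv J R = 0) → R = 0 := by
    intro R hR h
    rw [eq_C_of_pderiv_eq_zero h] at hR ⊢
    have := (mem_dualIdeal_iff hd k).mp hR 0 _ (isSingularAt_singularPart hd k 0 0)
    rw [eval_C] at this
    rw [this, C_0]
  induction N with
  | zero =>
    intro R hR h0 hN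
    refine hconst R hR fun J => ?_
    by_contra hJ
    have := totalDegree_pderiv_lt hJ
    omega
  | succ N ih =>
    intro R hR h0 hN
    refine hconst R hR fun J => ?_
    by_contra hJ
    refine hJ (ih _ (pderiv_mem_dualIdeal hd k hH₀ hR h0 J) ?_ ?_)
    · rw [pderiv_pderiv_comm, h0, map_zero]
    · have := totalDegree_pderiv_lt hJ
      omega

theorem isHypersurface_dualVariety (hT : 0 < ∑ i, n i)
    (hnd : ∀ i, d i = 1 → 2 * n i ≤ ∑ j, n j) (hd : ∀ i, 0 < d i) :
    IsHypersurface (dualVariety (segreVeronese n d)) := by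
  classical
  let k : (i : Fin r) → Fin (n i + 1) := fun _ => 0
  obtain ⟨H₀, hH₀⟩ := exists_hessian_ne_zero hT hnd hd k
  obtain ⟨F, hFp, hF⟩ := exists_prime_eq_span (baseIndex d k) (dualIdeal hd k)
    (dualIdeal_ne_bot hd k) (by
      intro a ha
      have h1 := eq_zero_of_mem_dualIdeal hd k (hH₀ 0) _ _ ha (by
        apply pderiv_eq_zero_of_notMem_vars
        intro hmem
        obtain ⟨J, -, hJ⟩ := Finset.mem_image.mp (vars_rename _ _ hmem)
        exact J.2 hJ) le_rfl
      rw [← map_zero (rename Subtype.val)] at h1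
      exact rename_injective _ Subtype.val_injective h1)
  have hmemF : F ∈ dualIdeal hd k := by
    rw [hF]
    exact Ideal.mem_span_singleton_self F
  have hcomp : ∀ e, F ∣ homogeneousComponent e F := by
    intro e
    rw [← Ideal.mem_span_singleton, ← hF, mem_dualIdeal_iff]
    intro y H hs
    exact eval_homogeneousComponent_eq_zero
      (fun c => (mem_dualIdeal_iff hd k).mp hmemF y _ (hs.smul c)) e
  have hhom := isHomogeneous_of_dvd_homogeneousComponent hFp.ne_zero hcomp
  refine ⟨F, F.totalDegree, ?_, hFp.ne_zero, hhom, ?_⟩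
  · rw [Nat.pos_iff_ne_zero]
    intro h0
    rw [totalDegree_eq_zero_iff_eq_C] at h0
    apply hFp.not_isUnit
    rw [h0]
    refine IsUnit.map C (IsUnit.mk0 _ fun h => hFp.ne_zero ?_)
    rw [h0, h, C_0]
  · ext p
    rw [mem_dualVariety_iff hd]
    constructor
    · intro h
      exact h F _ hhom fun k' y H _ hs => eval_eq_zero_of_isSingularAt hd k
        ((mem_dualIdeal_iff hd k).mp hmemF) hs
    · intro hp G e hG hvan
      have hGI : G ∈ dualIdeal hd k := by
        rw [mem_dualIdeal_iff]
        intro y H hs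
        -- The zero form is no projective point; homogeneity reaches it as 0 times a nonzero
        -- singular form.
        by_cases hH : H = 0
        · have h1 : singularPart hd k y H₀ ≠ 0 := by
            apply ne_zero_of_hessian_ne_zero hT (k := k) (y := y)
            rw [hessian_singularPart]
            exact hH₀ y
          have h2 := eval_smul_of_isHomogeneous hG 0 (singularPart hd k y H₀)
          rwa [hvan k y _ h1 (isSingularAt_singularPart hd k y H₀), mul_zero, zero_smul,
            ← hH] at h2
        · exact hvan k y H hH hs
      rw [hF, Ideal.mem_span_singleton] at hGI
      obtain ⟨Q, rfl⟩ := hGI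
      rw [map_mul]
      apply mul_eq_zero_of_left
      exact hp

end DualHypersurface

end SegreVeronese

end

theorem mainTheorem2 (m : ℕ) (n d : Fin (m + 1) → ℕ) (hn : ∀ i, 0 < n i) (hd : ∀ i, 0 < d i)
    (hmono : Monotone n) :
    (SegreVeronese.IsOneWeaklyDefective (SegreVeronese.segreVeronese n d) ↔
      d (Fin.last m) = 1 ∧ ∑ i : Fin m, n i.castSucc < n (Fin.last m)) ∧
    (SegreVeronese.IsHypersurface
        (SegreVeronese.dualVariety (SegreVeronese.segreVeronese n d)) ↔
      ¬ (d (Fin.last m) = 1 ∧ ∑ i : Fin m, n i.castSucc < n (Fin.last m))) := by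
  by_cases h : d (Fin.last m) = 1 ∧ ∑ i : Fin m, n i.castSucc < n (Fin.last m)
  · exact ⟨iff_of_true (SegreVeronese.isOneWeaklyDefective_of_lt hd h.1 h.2) h,
      iff_of_false (SegreVeronese.not_isHypersurface_of_lt hn hd h.1 h.2) (not_not.mpr h)⟩
  · have hsum := Fin.sum_univ_castSucc n
    have hT : 0 < ∑ i, n i := by
      have := hn (Fin.last m)
      omega
    have hnd : ∀ i, d i = 1 → 2 * n i ≤ ∑ j, n j := by
      intro i hi
      induction i using Fin.lastCases with
      | last =>
        have : ¬ ∑ i : Fin m, n i.castSucc < n (Fin.last m) := fun h' => h ⟨hi, h'⟩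
        omega
      -- By monotonicity a factor before the last is bounded by the last one and also by the sum of
      -- all but the last, so only the last factor can exceed half of the total.
      | cast i =>
        have h1 : n i.castSucc ≤ n (Fin.last m) := hmono (Fin.le_last _)
        have h2 : n i.castSucc ≤ ∑ j : Fin m, n j.castSucc :=
          Finset.single_le_sum (f := fun j : Fin m => n j.castSucc) (fun _ _ => Nat.zero_le _)
            (Finset.mem_univ i)
        omega
    exact ⟨iff_of_false (SegreVeronese.not_isOneWeaklyDefective hT hnd hd) h,
      iff_of_true (SegreVeronese.isHypersurface_dualVariety hT hnd hd) h⟩
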